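/- **PAC-Bayes generalization bounds for data re-uploading quantum models.** There is a universal constant $c>0$ such that the following two bounds hold. *Setting.* Let $\mathcal X$ be a measurable input space, $L\ge 1$ a number of layers, $N\ge 1$ a sample size, $\gamma>0$ and $0<\delta<1$. A data re-uploading model has output state $$\rho_{\rm out}(x)=\bigl(\phi_L\circ\mathcal E_L^{x}\circ\phi_{L-1}\circ\mathcal E_{L-1}^{x}\circ\cdots\circ\phi_1\circ\mathcal E_1^{x}\bigr)(\rho_0),$$ where $\rho_0$ is a fixed state, each $\mathcal E_j^{x}$ is an arbitrary quantum channel (completely positive and trace preserving) from the input space of $\phi_j$ to itself, depending measurably on $x\in\mathcal X$, and each trainable layer $\phi_j$ is a quantum channel given by a matrix $W_j$ in one of the two ways below. The output space has dimension $K\ge 2$, labels are $y\in\{1,\dots,K\}$, and $f_{w}(x)[k]=\mathrm{Tr}(|k\rangle\langle k|\,\rho_{\rm out}(x))$, where $w=(W_1,\dots,W_L)$. For a probability distribution $\mathcal D$ on $\mathcal X\times\{1,\dots,K\}$ let $L_\gamma(f)=\mathbb P_{(x,y)\sim\mathcal D}\bigl[f(x)[y]\le\gamma+\max_{k\ne y}f(x)[k]\bigr]$,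 and let $\hat L_\gamma(f)$ be the corresponding fraction of an i.i.d. sample of size $N$ from $\mathcal D$. For each layer fix in advance (independently of the sample) a sparsity pattern $S_j$, i.e. a set of $\xi_j$ matrix positions outside of which $W_j$ vanishes; put $\xi_{\max}=\max_j\xi_j$. Let $\|W\|_{1,1}$ be the sum of the absolute values of the entries, $\|W\|_F$ the Frobenius norm, $\|w\|^2=\sum_{j}\|W_j\|_F^2$, and for $\beta, B\in\mathbb R$ $$\mathcal C(\beta,B)=\sqrt{\frac{\beta^2\,\xi_{\max}\ln\bigl(\sum_{j=1}^L2^{\xi_j}\bigr)\,\|w\|^2+\ln\Bigl(\tfrac{N}{\delta}\,\max\bigl\{1,\;L\min\{\gamma\sqrt N/\|w\|,\;B\}\bigr\}\Bigr)}{\gamma^2N}},$$ where the inner minimum is $B$ if $\|w\|=0$. **(PM)** Let all layers act on $n\ge1$ qubits, $\phi_j(\rho)=\sum_{A,B}\bigl(\tfrac{\delta_{A,B}}{4^n}+W_j(A,B)\bigr)\sigma_A\rho\,\sigma_B$ with $\sigma_A$ the $n$-qubit Pauli strings and $W_j$ complex. Then with probability at least $1-\delta$ over the sample, for all $w$ with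 $W_j$ supported on $S_j$ and every $\phi_j$ a quantum channel, $$L_0(f_w)\le\hat L_\gamma(f_w)+c\;\mathcal C\bigl(\beta_{\rm PM},\,M(n,L,\xi_{\max})\bigr),$$ $$\beta_{\rm PM}=\sum_{j=1}^L\prod_{\ell=j+1}^L\|W_\ell\|_{1,1},\qquad M(n,L,\xi)=\frac{q^L-1}{q-1},\quad q=\frac{2\xi^2+\xi-2}{4^n}.$$ **(PTM)** Let $\phi_j$ map $d_{\rm in}^{(j)}$-dimensional to $d_{\rm out}^{(j)}$-dimensional multi-qubit systems (dimensions powers of two, $d^{(j)}_{\rm out}=d_{\rm in}^{(j+1)}$), $\phi_j(\rho)=\frac1{\sqrt{d_{\rm in}^{(j)}d_{\rm out}^{(j)}}}\sum_{A,B}\Bigl(\delta_{A,0}\delta_{B,0}\sqrt{d_{\rm in}^{(j)}/d_{\rm out}^{(j)}}+W_j(A,B)\Bigr)\mathrm{Tr}(\sigma_B\rho)\,\sigma_A$ with $W_j$ real. Then with probability at least $1-\delta$ over the sample, for all $w$ with $W_j$ supported on $S_j$ and every $\phi_j$ a quantum channel, and for all numbers $C_\ell\ge\|W_\ell\|_{1,1}$,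 $$L_0(f_w)\le\hat L_\gamma(f_w)+c\;\mathcal C\bigl(\beta_{\rm PTM},\,F(C_\ell)\bigr),$$ $$\beta_{\rm PTM}=\sqrt{d_{\rm out}^{(L)}}\sum_{j=1}^L\frac1{\sqrt{d_{\rm in}^{(j)}}}\prod_{\ell=j+1}^L\|W_\ell\|_{1,1},\qquad F(C_\ell)=\sqrt{d_{\rm out}^{(L)}}\sum_{j=1}^L\frac1{\sqrt{d_{\rm in}^{(j)}}}\prod_{\ell=j+1}^LC_\ell .$$ -/

import Mathlib

open MeasureTheory
open scoped ComplexOrder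

universe u

noncomputable section

namespace QModel

/-! ### Operators, states and channels on qubits -/

/-- Labels of the computational basis of `n` qubits (there are `2 ^ n` of them). -/
abbrev Basis2 (n : ℕ) : Type := Fin n → Fin 2

/-- Linear operators on the `n`-qubit Hilbert space, as matrices in the computational basis. -/
abbrev Op (n : ℕ) : Type := Matrix (Basis2 n) (Basis2 n) ℂ

/-- Density operators. -/
def IsState {n : ℕ} (ρ : Op n) : Prop := ρ.PosSemidef ∧ ρ.trace = 1

/-- The map `id ⊗ Φ` on operators of a `k`-dimensional ancilla tensored with the system:
`Φ` is applied to every block. -/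
def ampliation {n m : ℕ} (k : ℕ) (Φ : Op n →ₗ[ℂ] Op m)
    (X : Matrix (Fin k × Basis2 n) (Fin k × Basis2 n) ℂ) :
    Matrix (Fin k × Basis2 m) (Fin k × Basis2 m) ℂ :=
  Matrix.of fun p q => Φ (Matrix.of fun a b => X (p.1, a) (q.1, b)) p.2 q.2

/-- Complete positivity: `id_k ⊗ Φ` preserves positive semidefiniteness for every `k`. -/
def IsCompletelyPositive {n m : ℕ} (Φ : Op n →ₗ[ℂ] Op m) : Prop :=
  ∀ (k : ℕ) (X : Matrix (Fin k × Basis2 n) (Fin k × Basis2 n) ℂ),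
    X.PosSemidef → (ampliation k Φ X).PosSemidef

/-- Quantum channels: completely positive trace-preserving maps. -/
def IsChannel {n m : ℕ} (Φ : Op n →ₗ[ℂ] Op m) : Prop :=
  IsCompletelyPositive Φ ∧ ∀ X : Op n, (Φ X).trace = X.trace

/-! ### Pauli strings and the two parameterizations of a channel -/

/-- Labels of the `n`-qubit Pauli strings. The label `0` is the identity. -/
abbrev PauliIdx (n : ℕ) : Type := Fin n → Fin 4

/-- The matrices `I, X, Y, Z`. -/
def pauli1 : Fin 4 → Matrix (Fin 2) (Fin 2) ℂ :=
  ![!![1, 0; 0, 1], !![0, 1; 1, 0], !![0, -Complex.I; Complex.I, 0], !![1, 0; 0, -1]]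

/-- The Pauli string `σ_A = σ_{A 0} ⊗ σ_{A 1} ⊗ ⋯`. -/
def pauli {n : ℕ} (A : PauliIdx n) : Op n :=
  Matrix.of fun a b => ∏ q, pauli1 (A q) (a q) (b q)

/-- The process matrix `χ(A, B) = δ_{A,B} / 4 ^ n + W(A, B)`. -/
def processMatrix {n : ℕ} (W : Matrix (PauliIdx n) (PauliIdx n) ℂ) (A B : PauliIdx n) : ℂ :=
  (if A = B then 1 / (4 : ℂ) ^ n else 0) + W A B

/-- The map `ρ ↦ ∑_{A,B} χ(A, B) σ_A ρ σ_B` with deviation matrix `W`. -/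
def pmMap {n : ℕ} (W : Matrix (PauliIdx n) (PauliIdx n) ℂ) : Op n →ₗ[ℂ] Op n where
  toFun ρ := ∑ A, ∑ B, processMatrix W A B • (pauli A * ρ * pauli B)
  map_add' ρ τ := by
    simp only [mul_add, add_mul, smul_add, Finset.sum_add_distrib]
  map_smul' c ρ := by
    simp only [Matrix.mul_smul, Matrix.smul_mul, Finset.smul_sum, RingHom.id_apply]
    exact Finset.sum_congr rfl fun A _ => Finset.sum_congr rfl fun B _ => smul_comm _ _ _

/-- The Pauli transfer matrix `R(A, B) = δ_{A,0} δ_{B,0} √(d_in / d_out) + W(A, B)`, where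
`d_in = 2 ^ n` and `d_out = 2 ^ m`. Its entries are real, as for every quantum channel. -/
def transferMatrix {n m : ℕ} (W : Matrix (PauliIdx m) (PauliIdx n) ℝ)
    (A : PauliIdx m) (B : PauliIdx n) : ℝ :=
  (if A = 0 ∧ B = 0 then √((2 : ℝ) ^ n / 2 ^ m) else 0) + W A B

/-- The map `ρ ↦ (d_in d_out)^{-1/2} ∑_{A,B} R(A, B) Tr(σ_B ρ) σ_A` with deviation matrix `W`. -/
def ptmMap {n m : ℕ} (W : Matrix (PauliIdx m) (PauliIdx n) ℝ) : Op n →ₗ[ℂ] Op m where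
  toFun ρ := ((1 / √((2 : ℝ) ^ n * 2 ^ m) : ℝ) : ℂ) •
    ∑ A, ∑ B, ((transferMatrix W A B : ℂ) * (pauli B * ρ).trace) • pauli A
  map_add' ρ τ := by
    simp only [mul_add, Matrix.trace_add, add_smul, Finset.sum_add_distrib, smul_add]
  map_smul' c ρ := by
    simp only [Matrix.mul_smul, Matrix.trace_smul, Finset.smul_sum, RingHom.id_apply, smul_smul,
      smul_eq_mul]
    refine Finset.sum_congr rfl fun A _ => Finset.sum_congr rfl fun B _ => ?_
    congr 1
    ring

/-! ### Norms and supports of deviation matrices -/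

/-- The entrywise norm `‖W‖_{1,1}`. -/
def norm11 {ι κ 𝕜 : Type} [Fintype ι] [Fintype κ] [RCLike 𝕜] (W : Matrix ι κ 𝕜) : ℝ :=
  ∑ a, ∑ b, ‖W a b‖

/-- The squared Frobenius norm `‖W‖_F²`. -/
def frobSq {ι κ 𝕜 : Type} [Fintype ι] [Fintype κ] [RCLike 𝕜] (W : Matrix ι κ 𝕜) : ℝ :=
  ∑ a, ∑ b, ‖W a b‖ ^ 2

/-- All nonzero entries of `W` lie in the sparsity pattern `S`. -/
def SupportedOn {ι κ 𝕜 : Type} [RCLike 𝕜] (W : Matrix ι κ 𝕜) (S : Finset (ι × κ)) : Prop :=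
  ∀ a b, (a, b) ∉ S → W a b = 0

/-! ### Data re-uploading models -/

/-- The output operator `(φ_L ∘ E_L ∘ ⋯ ∘ φ_1 ∘ E_1)(ρ₀)`. The trainable layer `φ j` maps
operators on `n j` qubits to operators on `n (j + 1)` qubits; layers are numbered from `0`. -/
def reuploadOutput {L : ℕ} (n : Fin (L + 1) → ℕ)
    (φ : ∀ j : Fin L, Op (n j.castSucc) →ₗ[ℂ] Op (n j.succ))
    (E : ∀ j : Fin L, Op (n j.castSucc) →ₗ[ℂ] Op (n j.castSucc))
    (ρ₀ : Op (n 0)) : Op (n (Fin.last L)) :=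
  Fin.induction (motive := fun j => Op (n j)) ρ₀ (fun j ρ => φ j (E j ρ)) (Fin.last L)

/-- The outcome probabilities `Tr(|k⟩⟨k| ρ)` of the computational basis measurement. -/
def measure {n : ℕ} (ρ : Op n) (k : Basis2 n) : ℝ :=
  ((Matrix.single k k (1 : ℂ) * ρ).trace).re

/-- The re-uploading model `x ↦ f_w(x)` with process-matrix layers. -/
def pmModel {X : Type u} {n L : ℕ} (E : Fin L → X → Op n →ₗ[ℂ] Op n) (ρ₀ : Op n)
    (W : Fin L → Matrix (PauliIdx n) (PauliIdx n) ℂ) (x : X) : Basis2 n → ℝ :=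
  measure (reuploadOutput (fun _ => n) (fun j => pmMap (W j)) (fun j => E j x) ρ₀)

/-- The re-uploading model `x ↦ f_w(x)` with Pauli-transfer-matrix layers. -/
def ptmModel {X : Type u} {L : ℕ} (n : Fin (L + 1) → ℕ)
    (E : ∀ j : Fin L, X → Op (n j.castSucc) →ₗ[ℂ] Op (n j.castSucc)) (ρ₀ : Op (n 0))
    (W : ∀ j : Fin L, Matrix (PauliIdx (n j.succ)) (PauliIdx (n j.castSucc)) ℝ) (x : X) :
    Basis2 (n (Fin.last L)) → ℝ :=
  measure (reuploadOutput n (fun j => ptmMap (W j)) (fun j => E j x) ρ₀)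

/-- An input-dependent encoding: for each input a quantum channel, depending measurably on it. -/
def IsEncoding {X : Type u} [MeasurableSpace X] {n : ℕ} (E : X → Op n →ₗ[ℂ] Op n) : Prop :=
  (∀ x, IsChannel (E x)) ∧ ∀ (ρ : Op n) (a b : Basis2 n), Measurable fun x => E x ρ a b

/-! ### Margin losses -/

/-- The event `v[y] ≤ γ + max_{k ≠ y} v[k]`. -/
def MarginError {Y : Type} (γ : ℝ) (v : Y → ℝ) (y : Y) : Prop :=
  v y ≤ γ + ⨆ k : {k : Y // k ≠ y}, v k

/-- The expected margin loss `L_γ(f)` under the distribution `D` of labeled examples. -/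
def expectedLoss {X : Type u} [MeasurableSpace X] {Y : Type} [MeasurableSpace Y]
    (D : Measure (X × Y)) (γ : ℝ) (f : X → Y → ℝ) : ℝ :=
  D.real {p | MarginError γ (f p.1) p.2}

open Classical in
/-- The empirical margin loss of `f` on the sample `s` of size `N`. -/
def empiricalLoss {X : Type u} {Y : Type} {N : ℕ} (s : Fin N → X × Y) (γ : ℝ)
    (f : X → Y → ℝ) : ℝ :=
  (∑ i, if MarginError γ (f (s i).1) (s i).2 then (1 : ℝ) else 0) / N

/-! ### The complexity terms -/

/-- `β_PM = ∑_j ∏_{ℓ > j} ‖W_ℓ‖_{1,1}`, as a function of the numbers `c ℓ = ‖W_ℓ‖_{1,1}`. -/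
def betaPM {L : ℕ} (c : Fin L → ℝ) : ℝ :=
  ∑ j, ∏ l ∈ Finset.Ioi j, c l

/-- `√d_out^{(L)} ∑_j (d_in^{(j)})^{-1/2} ∏_{ℓ > j} c_ℓ`. This is `β_PTM` for
`c ℓ = ‖W_ℓ‖_{1,1}` and `F(C_ℓ)` for `c ℓ = C_ℓ`. -/
def betaPTM {L : ℕ} (n : Fin (L + 1) → ℕ) (c : Fin L → ℝ) : ℝ :=
  √((2 : ℝ) ^ n (Fin.last L)) * ∑ j : Fin L, 1 / √((2 : ℝ) ^ n j.castSucc) *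
    ∏ l ∈ Finset.Ioi j, c l

/-- The largest sparsity `ξ_max`. -/
def xiMax {L : ℕ} (ξ : Fin L → ℕ) : ℕ := Finset.univ.sup ξ

/-- `M(n, L, ξ) = (C ^ L - 1) / (C - 1)` with `C = (2 ξ² + ξ - 2) / 4 ^ n`
(for `n ≥ 1` and natural `ξ` the number `C` is never `1`). -/
def boundM (n L ξ : ℕ) : ℝ :=
  (((2 * (ξ : ℝ) ^ 2 + ξ - 2) / 4 ^ n) ^ L - 1) / ((2 * (ξ : ℝ) ^ 2 + ξ - 2) / 4 ^ n - 1)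

/-- The size `max {1, L min {γ √N / √(∑_j ‖W_j‖_F²), M}}` of the covering net of the values of
`β`; here `w2 = ∑_j ‖W_j‖_F²`, and the first entry of the minimum is `∞` when `w2 = 0`. -/
def netSize (L N : ℕ) (γ w2 M : ℝ) : ℝ :=
  max 1 (L * if w2 = 0 then M else min (γ * √N / √w2) M)

/-- The complexity term
`√((β² ξ_max ln(∑_j 2^{ξ_j}) w2 + ln(N · netSize / δ)) / (γ² N))`. -/
def complexity {L : ℕ} (N : ℕ) (ξ : Fin L → ℕ) (γ δ β w2 M : ℝ) : ℝ :=
  √((β ^ 2 * xiMax ξ * Real.log (∑ j, (2 : ℝ) ^ ξ j) * w2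
    + Real.log (N * netSize L N γ w2 M / δ)) / (γ ^ 2 * N))

end QModel

end

/-! The proof is an Occam argument: a weighted union bound over a countable family of codes of the
parameters, each decoded to a fixed representative.

Stability. Each layer is the completely depolarizing channel plus a deviation linear in `W j`. The
difference of two states is traceless, so the depolarizing part kills it; the deviation expands the
trace norm by at most `norm11 (W j)` (times `√(d_out / d_in)` for transfer matrices), and the
encodings contract it. Gronwall then gives the Lipschitz constant `β` with respect to the largest
`norm11` distance between corresponding layers (`traceNorm_reuploadState_sub_le`). The same
splitting of the last layer bounds every margin by its deviation.

Coding. At precision `t`, layers with `norm11 ≤ t` are skipped for free; the others are rounded on a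
grid of mesh `t / ξ_max`. With `Λ = ln ∑ 2^ξ_j`, the code length is of order `ξ_max * Λ * ‖w‖² / t²`
(`neg_log_codeWeight_encode_le`). Parameters with the same code are within `4 * t` in each layer.

Combination. Hoeffding and the union bound (`exists_uniform_event`) hold for all codes at all dyadic
precisions, tested at margin `γ / 2`. For given `W` one takes `t ~ γ / β` (`exists_scale`), so that
the representative has margins within `γ / 2` of those of `W`. If all margins of `W` are at most
`γ`, or the complexity is large, the bound is trivial; otherwise the lower bounds this forces on `β²
* ξ_max * ‖w‖² / γ²` and on `N` absorb the additive constants and put the cost of naming the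
precision below `ln N`. Hence the bound holds even with the net size replaced by `1`. -/

noncomputable section

namespace QModel

/-! ### Trace norm by duality, and the Jordan decomposition. -/

section TraceNorm

open scoped Matrix.Norms.L2Operator

variable {ι : Type*} [Fintype ι] [DecidableEq ι]

/-- The functional `K ↦ Tr(K X)`. -/
def traceFunctional (X : Matrix ι ι ℂ) : Matrix ι ι ℂ →L[ℂ] ℂ :=
  LinearMap.toContinuousLinearMap
    ((Matrix.traceLinearMap ι ℂ ℂ).comp (LinearMap.mulRight ℂ X))

@[simp]
lemma traceFunctional_apply (X K : Matrix ι ι ℂ) : traceFunctional X K = (K * X).trace := rfl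

/-- The trace norm, as the norm dual to the operator norm. -/
def traceNorm (X : Matrix ι ι ℂ) : ℝ := ‖traceFunctional X‖

lemma traceNorm_nonneg (X : Matrix ι ι ℂ) : 0 ≤ traceNorm X := norm_nonneg _

lemma norm_trace_mul_le (K X : Matrix ι ι ℂ) : ‖(K * X).trace‖ ≤ traceNorm X * ‖K‖ :=
  (traceFunctional X).le_opNorm K

lemma traceNorm_le {X : Matrix ι ι ℂ} {a : ℝ} (ha : 0 ≤ a)
    (h : ∀ K, ‖(K * X).trace‖ ≤ a * ‖K‖) : traceNorm X ≤ a :=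
  ContinuousLinearMap.opNorm_le_bound _ ha h

lemma traceFunctional_add (X Y : Matrix ι ι ℂ) :
    traceFunctional (X + Y) = traceFunctional X + traceFunctional Y := by
  ext K; simp [mul_add]

lemma traceFunctional_smul (c : ℂ) (X : Matrix ι ι ℂ) :
    traceFunctional (c • X) = c • traceFunctional X := by
  ext K; simp

@[simp]
lemma traceNorm_zero : traceNorm (0 : Matrix ι ι ℂ) = 0 :=
  le_antisymm (traceNorm_le le_rfl (by simp)) (traceNorm_nonneg _)

lemma traceNorm_add_le (X Y : Matrix ι ι ℂ) : traceNorm (X + Y) ≤ traceNorm X + traceNorm Y := by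
  rw [traceNorm, traceFunctional_add]; exact norm_add_le _ _

lemma traceNorm_smul (c : ℂ) (X : Matrix ι ι ℂ) : traceNorm (c • X) = ‖c‖ * traceNorm X := by
  rw [traceNorm, traceFunctional_smul]; exact norm_smul _ _

lemma traceNorm_neg (X : Matrix ι ι ℂ) : traceNorm (-X) = traceNorm X := by
  rw [← neg_one_smul ℂ X, traceNorm_smul]; simp

lemma traceNorm_sub_le (X Y : Matrix ι ι ℂ) : traceNorm (X - Y) ≤ traceNorm X + traceNorm Y := by
  rw [sub_eq_add_neg, ← traceNorm_neg Y]; exact traceNorm_add_le _ _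

lemma traceNorm_sum_le {κ : Type*} (s : Finset κ) (X : κ → Matrix ι ι ℂ) :
    traceNorm (∑ k ∈ s, X k) ≤ ∑ k ∈ s, traceNorm (X k) :=
  Finset.le_sum_of_subadditive _ traceNorm_zero.le traceNorm_add_le _ _

lemma traceNorm_mul_mul_le (A X B : Matrix ι ι ℂ) (hA : ‖A‖ ≤ 1) (hB : ‖B‖ ≤ 1) :
    traceNorm (A * X * B) ≤ traceNorm X := by
  refine traceNorm_le (traceNorm_nonneg _) fun K => ?_
  have h : (K * (A * X * B)).trace = (B * K * A * X).trace := by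
    rw [← mul_assoc, Matrix.trace_mul_comm]; simp only [mul_assoc]
  rw [h]
  refine (norm_trace_mul_le _ _).trans (mul_le_mul_of_nonneg_left ?_ (traceNorm_nonneg _))
  calc ‖B * K * A‖ ≤ ‖B‖ * ‖K‖ * ‖A‖ :=
        (norm_mul_le _ _).trans (mul_le_mul_of_nonneg_right (norm_mul_le _ _) (norm_nonneg _))
    _ ≤ 1 * ‖K‖ * 1 := by gcongr
    _ = ‖K‖ := by ring

lemma norm_star_dotProduct_mulVec_le (K : Matrix ι ι ℂ) (v : ι → ℂ) :
    ‖star v ⬝ᵥ K.mulVec v‖ ≤ ‖K‖ * (star v ⬝ᵥ v).re := by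
  have h1 : star v ⬝ᵥ K.mulVec v
      = inner ℂ (WithLp.toLp 2 v : EuclideanSpace ℂ ι) (WithLp.toLp 2 (K.mulVec v)) := by
    rw [EuclideanSpace.inner_toLp_toLp, dotProduct_comm]
  have h2 : (star v ⬝ᵥ v).re = ‖(WithLp.toLp 2 v : EuclideanSpace ℂ ι)‖ ^ 2 := by
    rw [← inner_self_eq_norm_sq (𝕜 := ℂ), EuclideanSpace.inner_toLp_toLp, dotProduct_comm]; rfl
  rw [h1, h2]
  refine (norm_inner_le_norm _ _).trans ?_
  have := Matrix.l2_opNorm_mulVec K (WithLp.toLp 2 v : EuclideanSpace ℂ ι)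
  simp only at this
  calc _ ≤ ‖(WithLp.toLp 2 v : EuclideanSpace ℂ ι)‖ *
        (‖K‖ * ‖(WithLp.toLp 2 v : EuclideanSpace ℂ ι)‖) := by gcongr; exact this
    _ = _ := by ring

/-- A sum of rank-one terms `v v*` pairs with `K` to a sum of values `⟨v, K v⟩`, each at most `‖K‖
‖v‖²`. -/
lemma traceNorm_le_of_posSemidef {P : Matrix ι ι ℂ} (hP : P.PosSemidef) :
    traceNorm P ≤ P.trace.re := by
  obtain ⟨m, v, rfl⟩ := Matrix.posSemidef_iff_eq_sum_vecMulVec.mp hP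
  have hnn : ∀ i, 0 ≤ (star (v i) ⬝ᵥ v i).re := fun i =>
    (Complex.le_def.mp (dotProduct_star_self_nonneg (v i))).1
  have htr : (∑ i, Matrix.vecMulVec (v i) (star (v i))).trace.re
      = ∑ i, (star (v i) ⬝ᵥ v i).re := by
    rw [Matrix.trace_sum, Complex.re_sum]
    exact Finset.sum_congr rfl fun i _ => by rw [Matrix.trace_vecMulVec, dotProduct_comm]
  rw [htr]
  refine traceNorm_le (Finset.sum_nonneg fun i _ => hnn i) fun K => ?_
  rw [Finset.mul_sum, Matrix.trace_sum, Finset.sum_mul]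
  refine (norm_sum_le _ _).trans (Finset.sum_le_sum fun i _ => ?_)
  rw [Matrix.mul_vecMulVec, Matrix.trace_vecMulVec, dotProduct_comm, mul_comm _ ‖K‖]
  exact norm_star_dotProduct_mulVec_le K (v i)

lemma norm_le_one_of_star_mul_self_eq_one {U : Matrix ι ι ℂ} (h : star U * U = 1) : ‖U‖ ≤ 1 := by
  have h1 : ‖(1 : Matrix ι ι ℂ)‖ ≤ 1 := by
    rw [← Matrix.diagonal_one, Matrix.l2_opNorm_diagonal, pi_norm_le_iff_of_nonneg zero_le_one]
    simp
  rw [← h, CStarRing.norm_star_mul_self] at h1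
  nlinarith [norm_nonneg U]

/-- Positive and negative parts in an eigenbasis. Testing the trace norm against the sign of `X`,
which has operator norm at most `1`, produces the sum of the absolute eigenvalues. -/
lemma exists_posSemidef_sub_of_isHermitian {X : Matrix ι ι ℂ} (hX : X.IsHermitian) :
    ∃ P Q : Matrix ι ι ℂ, P.PosSemidef ∧ Q.PosSemidef ∧ X = P - Q ∧
      P.trace.re + Q.trace.re ≤ traceNorm X := by
  set U : Matrix ι ι ℂ := (hX.eigenvectorUnitary : Matrix ι ι ℂ) with hU
  have hUU : star U * U = 1 := Unitary.coe_star_mul_self hX.eigenvectorUnitary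
  have hUU' : U * star U = 1 := Unitary.coe_mul_star_self hX.eigenvectorUnitary
  set e := hX.eigenvalues with he
  let D : (ι → ℝ) → Matrix ι ι ℂ := fun f => U * Matrix.diagonal (fun i => (f i : ℂ)) * star U
  have hXD : X = D e := by
    have := hX.spectral_theorem
    rw [Unitary.conjStarAlgAut_apply] at this
    exact this
  have hD : ∀ f g, D f * D g = D (fun i => f i * g i) := by
    intro f g
    simp only [D]
    calc _ = U * Matrix.diagonal (fun i => (f i : ℂ)) * (star U * U) *
          Matrix.diagonal (fun i => (g i : ℂ)) * star U := by simp only [mul_assoc]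
      _ = _ := by
        rw [hUU, mul_one, mul_assoc U, Matrix.diagonal_mul_diagonal]
        simp
  have hsub : ∀ f g, D f - D g = D (fun i => f i - g i) := by
    intro f g
    simp only [D]
    rw [← sub_mul, ← mul_sub, Matrix.diagonal_sub]
    simp
  have htr : ∀ f, (D f).trace = ((∑ i, f i : ℝ) : ℂ) := by
    intro f
    simp only [D]
    rw [Matrix.trace_mul_comm, ← mul_assoc, hUU, one_mul, Matrix.trace_diagonal]
    simp
  have hpos : ∀ f, (∀ i, 0 ≤ f i) → (D f).PosSemidef := by
    intro f hf
    have : (Matrix.diagonal (fun i => (f i : ℂ))).PosSemidef :=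
      Matrix.PosSemidef.diagonal fun i => by simpa using hf i
    simpa [D, Matrix.star_eq_conjTranspose] using this.mul_mul_conjTranspose_same U
  have hnorm : ∀ f, (∀ i, |f i| ≤ 1) → ‖D f‖ ≤ 1 := by
    intro f hf
    have hd : ‖Matrix.diagonal (fun i => (f i : ℂ))‖ ≤ 1 := by
      rw [Matrix.l2_opNorm_diagonal, pi_norm_le_iff_of_nonneg zero_le_one]
      intro i; simpa using hf i
    have hU1 : ‖U‖ ≤ 1 := norm_le_one_of_star_mul_self_eq_one hUU
    have hU2 : ‖star U‖ ≤ 1 := by rwa [norm_star]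
    calc ‖D f‖ ≤ ‖U‖ * ‖Matrix.diagonal (fun i => (f i : ℂ))‖ * ‖star U‖ :=
          (norm_mul_le _ _).trans (mul_le_mul_of_nonneg_right (norm_mul_le _ _) (norm_nonneg _))
      _ ≤ 1 * 1 * 1 := by gcongr
      _ = 1 := by norm_num
  refine ⟨D fun i => max (e i) 0, D fun i => max (-e i) 0, hpos _ fun i => le_max_right _ _,
    hpos _ fun i => le_max_right _ _, ?_, ?_⟩
  · rw [hsub, hXD]
    congr 1
    ext i
    exact (max_zero_sub_eq_self (e i)).symm
  · set s : ι → ℝ := fun i => if 0 ≤ e i then 1 else -1 with hs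
    have h1 := norm_trace_mul_le (D s) X
    have h2 : ‖D s‖ ≤ 1 := hnorm _ fun i => by simp only [hs]; split_ifs <;> simp
    have h3 : D s * X = D fun i => |e i| := by
      conv_lhs => rw [hXD, hD]
      congr 1
      ext i
      simp only [hs]
      split_ifs with h
      · rw [abs_of_nonneg h, one_mul]
      · rw [abs_of_neg (not_le.mp h)]; ring
    rw [h3, htr] at h1
    rw [htr, htr, Complex.ofReal_re, Complex.ofReal_re, ← Finset.sum_add_distrib]
    calc ∑ i, (max (e i) 0 + max (-e i) 0) = ∑ i, |e i| :=
          Finset.sum_congr rfl fun i _ => by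
            rcases le_total 0 (e i) with h | h
            · rw [abs_of_nonneg h, max_eq_left h, max_eq_right (by linarith)]; ring
            · rw [abs_of_nonpos h, max_eq_right h, max_eq_left (by linarith)]; ring
      _ ≤ ‖((∑ i, |e i| : ℝ) : ℂ)‖ := by
          rw [Complex.norm_real]; exact le_abs_self _
      _ ≤ traceNorm X * ‖D s‖ := h1
      _ ≤ traceNorm X := mul_le_of_le_one_right (traceNorm_nonneg _) h2

end TraceNorm

/-! ### Channels contract the trace norm; measurements are controlled by it. -/

section Channels

variable {n m : ℕ}

lemma IsCompletelyPositive.posSemidef_map {Φ : Op n →ₗ[ℂ] Op m} (h : IsCompletelyPositive Φ)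
    {P : Op n} (hP : P.PosSemidef) : (Φ P).PosSemidef := by
  have h1 := h 1 _ (hP.submatrix (Prod.snd : Fin 1 × Basis2 n → Basis2 n))
  exact h1.submatrix fun a : Basis2 m => ((0 : Fin 1), a)

lemma IsChannel.isState_map {Φ : Op n →ₗ[ℂ] Op m} (h : IsChannel Φ) {ρ : Op n} (hρ : IsState ρ) :
    IsState (Φ ρ) :=
  ⟨h.1.posSemidef_map hρ.1, (h.2 ρ).trans hρ.2⟩

/-- The two Jordan parts stay positive and keep their traces. Hermitian operators suffice, since
only differences of states are propagated. -/
lemma IsChannel.traceNorm_map_le {Φ : Op n →ₗ[ℂ] Op m} (h : IsChannel Φ) {X : Op n}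
    (hX : X.IsHermitian) : traceNorm (Φ X) ≤ traceNorm X := by
  obtain ⟨P, Q, hP, hQ, hPQ, htr⟩ := exists_posSemidef_sub_of_isHermitian hX
  calc traceNorm (Φ X) = traceNorm (Φ P - Φ Q) := by rw [hPQ, map_sub]
    _ ≤ traceNorm (Φ P) + traceNorm (Φ Q) := traceNorm_sub_le _ _
    _ ≤ (Φ P).trace.re + (Φ Q).trace.re :=
        add_le_add (traceNorm_le_of_posSemidef (h.1.posSemidef_map hP))
          (traceNorm_le_of_posSemidef (h.1.posSemidef_map hQ))
    _ ≤ traceNorm X := by rw [h.2, h.2]; exact htr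

lemma IsState.traceNorm_le_one {ρ : Op n} (h : IsState ρ) : traceNorm ρ ≤ 1 :=
  (traceNorm_le_of_posSemidef h.1).trans_eq (by simp [h.2])

lemma measure_eq_re (ρ : Op n) (k : Basis2 n) : measure ρ k = (ρ k k).re := by
  simp [measure, Matrix.trace_single_mul]

lemma measure_sub (ρ τ : Op n) (k : Basis2 n) :
    measure (ρ - τ) k = measure ρ k - measure τ k := by
  simp [measure_eq_re]

open scoped Matrix.Norms.L2Operator in
lemma abs_measure_le (X : Op n) (k : Basis2 n) : |measure X k| ≤ traceNorm X := by
  have hs : ‖(Matrix.single k k (1 : ℂ) : Op n)‖ ≤ 1 := by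
    have : (Matrix.single k k (1 : ℂ) : Op n) = Matrix.diagonal (Pi.single k 1) := by
      rw [Matrix.diagonal_single]
    rw [this, Matrix.l2_opNorm_diagonal, pi_norm_le_iff_of_nonneg zero_le_one]
    intro i
    by_cases h : i = k
    · subst h; simp
    · simp [h]
  exact (Complex.abs_re_le_norm _).trans ((norm_trace_mul_le _ _).trans
    (mul_le_of_le_one_right (traceNorm_nonneg _) hs))

lemma IsState.measure_nonneg {ρ : Op n} (h : IsState ρ) (k : Basis2 n) : 0 ≤ measure ρ k := by
  rw [measure_eq_re]
  exact (Complex.le_def.mp h.1.diag_nonneg).1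

lemma IsState.measure_sub_le_one {ρ : Op n} (h : IsState ρ) (k k' : Basis2 n) :
    measure ρ k - measure ρ k' ≤ 1 := by
  have h1 := (le_abs_self _).trans ((abs_measure_le ρ k).trans h.traceNorm_le_one)
  linarith [h.measure_nonneg k']

end Channels

/-! ### Pauli strings, and layers as depolarizing channel plus deviation. -/

section Pauli

open scoped Matrix.Norms.L2Operator

variable {n m : ℕ}

lemma sum_basis_prod (f : Fin n → Fin 2 → ℂ) :
    ∑ c : Basis2 n, ∏ q, f q (c q) = ∏ q, ∑ i, f q i := by
  rw [Finset.prod_univ_sum, Fintype.piFinset_univ]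

lemma sum_pauliIdx_prod (f : Fin n → Fin 4 → ℂ) :
    ∑ A : PauliIdx n, ∏ q, f q (A q) = ∏ q, ∑ i, f q i := by
  rw [Finset.prod_univ_sum, Fintype.piFinset_univ]

lemma pauli1_mul_self (i : Fin 4) (a b : Fin 2) :
    ∑ c, pauli1 i a c * pauli1 i c b = if a = b then 1 else 0 := by
  fin_cases i <;> fin_cases a <;> fin_cases b <;> simp [pauli1]

lemma star_pauli1 (i : Fin 4) (a b : Fin 2) : star (pauli1 i b a) = pauli1 i a b := by
  fin_cases i <;> fin_cases a <;> fin_cases b <;> simp [pauli1]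

lemma sum_pauli1_mul_pauli1 (a b c d : Fin 2) :
    ∑ i, pauli1 i a c * pauli1 i d b = if a = b ∧ c = d then 2 else 0 := by
  fin_cases a <;> fin_cases b <;> fin_cases c <;> fin_cases d <;>
    simp [pauli1, Fin.sum_univ_four] <;> norm_num

lemma prod_ite_eq_one (a b : Basis2 n) :
    ∏ q, (if a q = b q then (1 : ℂ) else 0) = if a = b then 1 else 0 := by
  rw [Finset.prod_ite_zero]
  simp [funext_iff]

lemma pauli_mul_self (A : PauliIdx n) : pauli A * pauli A = 1 := by
  ext a b
  rw [Matrix.mul_apply, Matrix.one_apply, ← prod_ite_eq_one]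
  simp only [pauli, Matrix.of_apply, ← Finset.prod_mul_distrib]
  rw [sum_basis_prod fun q c => pauli1 (A q) (a q) c * pauli1 (A q) c (b q)]
  exact Finset.prod_congr rfl fun q _ => pauli1_mul_self _ _ _

lemma star_pauli (A : PauliIdx n) : star (pauli A) = pauli A := by
  ext a b
  rw [Matrix.star_apply]
  simp only [pauli, Matrix.of_apply, star_prod, star_pauli1]

lemma norm_pauli_le_one (A : PauliIdx n) : ‖pauli A‖ ≤ 1 :=
  norm_le_one_of_star_mul_self_eq_one (by rw [star_pauli, pauli_mul_self])

lemma pauli_zero : pauli (0 : PauliIdx n) = 1 := by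
  ext a b
  rw [Matrix.one_apply, ← prod_ite_eq_one]
  simp only [pauli, Matrix.of_apply]
  refine Finset.prod_congr rfl fun q _ => ?_
  generalize a q = x
  generalize b q = y
  fin_cases x <;> fin_cases y <;> simp [pauli1]

/-- The Pauli twirl: entrywise, the sum factors over qubits into the one-qubit completeness relation
`sum_pauli1_mul_pauli1`. -/
lemma sum_pauli_mul_mul_pauli (X : Op n) :
    ∑ A : PauliIdx n, pauli A * X * pauli A = ((2 : ℂ) ^ n * X.trace) • (1 : Op n) := by
  ext a b
  rw [Matrix.sum_apply, Matrix.smul_apply, Matrix.one_apply]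
  simp only [Matrix.mul_apply, Finset.sum_mul, pauli, Matrix.of_apply]
  rw [Finset.sum_comm]
  simp_rw [Finset.sum_comm (γ := PauliIdx n)]
  have h : ∀ c d : Basis2 n, ∑ A : PauliIdx n,
      (∏ q, pauli1 (A q) (a q) (c q)) * X c d * ∏ q, pauli1 (A q) (d q) (b q)
      = (if a = b ∧ c = d then (2 : ℂ) ^ n else 0) * X c d := by
    intro c d
    have h1 : ∀ A : PauliIdx n,
        (∏ q, pauli1 (A q) (a q) (c q)) * X c d * ∏ q, pauli1 (A q) (d q) (b q)
        = (∏ q, pauli1 (A q) (a q) (c q) * pauli1 (A q) (d q) (b q)) * X c d := by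
      intro A; rw [Finset.prod_mul_distrib]; ring
    simp_rw [h1]
    rw [← Finset.sum_mul,
      sum_pauliIdx_prod fun q i => pauli1 i (a q) (c q) * pauli1 i (d q) (b q)]
    congr 1
    simp_rw [sum_pauli1_mul_pauli1]
    rw [Finset.prod_ite_zero]
    simp [funext_iff, forall_and]
  rw [Finset.sum_comm]
  simp_rw [h]
  by_cases hab : a = b
  · simp [hab, Matrix.trace, Finset.mul_sum]
  · simp [hab]

lemma card_basis2 : Fintype.card (Basis2 n) = 2 ^ n := by simp

lemma traceNorm_pauli_le (A : PauliIdx n) : traceNorm (pauli A) ≤ 2 ^ n := by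
  have h1 : traceNorm (1 : Op n) ≤ 2 ^ n := by
    refine (traceNorm_le_of_posSemidef Matrix.PosSemidef.one).trans_eq ?_
    rw [Matrix.trace_one, card_basis2, Complex.natCast_re]; push_cast; rfl
  refine le_trans ?_ h1
  have := traceNorm_mul_mul_le (pauli A) 1 1 (norm_pauli_le_one A)
    (norm_le_one_of_star_mul_self_eq_one (by simp))
  simpa using this

/-- The part of a process-matrix layer that is given by the deviation matrix. -/
def pmDeviation (W : Matrix (PauliIdx n) (PauliIdx n) ℂ) (X : Op n) : Op n :=
  ∑ A, ∑ B, W A B • (pauli A * X * pauli B)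

/-- The first term vanishes on traceless `X` and does not depend on `W`, so contraction and
dependence on the parameters are both governed by the deviation. -/
lemma pmMap_eq (W : Matrix (PauliIdx n) (PauliIdx n) ℂ) (X : Op n) :
    pmMap W X = (X.trace / 2 ^ n) • (1 : Op n) + pmDeviation W X := by
  have h1 : pmMap W X = ∑ A, ∑ B, processMatrix W A B • (pauli A * X * pauli B) := rfl
  rw [h1]
  simp only [processMatrix, add_smul, Finset.sum_add_distrib, ite_smul, zero_smul,
    Finset.sum_ite_eq, Finset.mem_univ, if_true]
  rw [← Finset.smul_sum, sum_pauli_mul_mul_pauli, smul_smul]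
  have h4 : (4 : ℂ) ^ n = 2 ^ n * 2 ^ n := by rw [← mul_pow]; norm_num
  congr 2
  rw [h4]
  field_simp

lemma pmDeviation_sub (W W' : Matrix (PauliIdx n) (PauliIdx n) ℂ) (X : Op n) :
    pmDeviation (W - W') X = pmDeviation W X - pmDeviation W' X := by
  simp [pmDeviation, sub_smul]

lemma traceNorm_pmDeviation_le (W : Matrix (PauliIdx n) (PauliIdx n) ℂ) (X : Op n) :
    traceNorm (pmDeviation W X) ≤ norm11 W * traceNorm X := by
  unfold pmDeviation norm11
  rw [Finset.sum_mul]
  refine (traceNorm_sum_le _ _).trans (Finset.sum_le_sum fun A _ => ?_)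
  rw [Finset.sum_mul]
  refine (traceNorm_sum_le _ _).trans (Finset.sum_le_sum fun B _ => ?_)
  rw [traceNorm_smul]
  gcongr
  exact traceNorm_mul_mul_le _ _ _ (norm_pauli_le_one A) (norm_pauli_le_one B)

/-- The part of a Pauli-transfer-matrix layer that is given by the deviation matrix. -/
def ptmDeviation (W : Matrix (PauliIdx m) (PauliIdx n) ℝ) (X : Op n) : Op m :=
  ((1 / √((2 : ℝ) ^ n * 2 ^ m) : ℝ) : ℂ) •
    ∑ A, ∑ B, ((W A B : ℂ) * (pauli B * X).trace) • pauli A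

lemma ptmMap_eq (W : Matrix (PauliIdx m) (PauliIdx n) ℝ) (X : Op n) :
    ptmMap W X = (X.trace / 2 ^ m) • (1 : Op m) + ptmDeviation W X := by
  have h1 : ptmMap W X = ((1 / √((2 : ℝ) ^ n * 2 ^ m) : ℝ) : ℂ) •
    ∑ A, ∑ B, ((transferMatrix W A B : ℂ) * (pauli B * X).trace) • pauli A := rfl
  have h2 : ∀ (A : PauliIdx m) (B : PauliIdx n),
      ((transferMatrix W A B : ℂ) * (pauli B * X).trace) • pauli A =
      (if A = 0 then (if B = 0 then (((√((2 : ℝ) ^ n / 2 ^ m) : ℝ) : ℂ) * X.trace) • (1 : Op m)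
        else 0) else 0) + ((W A B : ℂ) * (pauli B * X).trace) • pauli A := by
    intro A B
    unfold transferMatrix
    by_cases hA : A = 0
    · by_cases hB : B = 0
      · subst hA hB
        simp only [and_self, if_true, pauli_zero, one_mul]
        rw [← add_smul]; congr 1; push_cast; ring
      · simp [hB]
    · simp [hA]
  rw [h1]
  simp_rw [h2, Finset.sum_add_distrib]
  rw [smul_add]
  congr 1
  simp only [Finset.sum_ite_irrel, Finset.sum_const_zero, Finset.sum_ite_eq', Finset.mem_univ,
    if_true]
  rw [smul_smul, ← mul_assoc, ← Complex.ofReal_mul]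
  have h3 : 1 / √((2 : ℝ) ^ n * 2 ^ m) * √((2 : ℝ) ^ n / 2 ^ m) = 1 / 2 ^ m := by
    rw [← Real.sqrt_one, ← Real.sqrt_div zero_le_one, ← Real.sqrt_mul (by positivity)]
    rw [show (1 : ℝ) / (2 ^ n * 2 ^ m) * (2 ^ n / 2 ^ m) = (1 / 2 ^ m) ^ 2 by field_simp]
    rw [Real.sqrt_sq (by positivity)]
    simp
  rw [h3]
  congr 1
  push_cast
  ring

lemma ptmDeviation_sub (W W' : Matrix (PauliIdx m) (PauliIdx n) ℝ) (X : Op n) :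
    ptmDeviation (W - W') X = ptmDeviation W X - ptmDeviation W' X := by
  simp [ptmDeviation, sub_smul, sub_mul, smul_sub]

/-- Each output Pauli string has trace norm at most `2 ^ m`; with the prefactor `1 / √(2 ^ n * 2 ^
m)` this gives the dimension ratio. -/
lemma traceNorm_ptmDeviation_le (W : Matrix (PauliIdx m) (PauliIdx n) ℝ) (X : Op n) :
    traceNorm (ptmDeviation W X) ≤ √(2 ^ m) / √(2 ^ n) * (norm11 W * traceNorm X) := by
  unfold ptmDeviation
  rw [traceNorm_smul, Complex.norm_real, Real.norm_of_nonneg (by positivity)]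
  have h : traceNorm (∑ A, ∑ B, ((W A B : ℂ) * (pauli B * X).trace) • pauli A : Op m)
      ≤ norm11 W * traceNorm X * 2 ^ m := by
    unfold norm11
    rw [Finset.sum_mul, Finset.sum_mul]
    refine (traceNorm_sum_le _ _).trans (Finset.sum_le_sum fun A _ => ?_)
    rw [Finset.sum_mul, Finset.sum_mul]
    refine (traceNorm_sum_le _ _).trans (Finset.sum_le_sum fun B _ => ?_)
    rw [traceNorm_smul, norm_mul, Complex.norm_real]
    have h1 := norm_trace_mul_le (pauli B) X
    have h2 := mul_le_of_le_one_right (traceNorm_nonneg X) (norm_pauli_le_one B)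
    have h3 := h1.trans h2
    have h4 := traceNorm_pauli_le A
    have h5 := traceNorm_nonneg X
    have h6 := traceNorm_nonneg (pauli A)
    gcongr
  calc _ ≤ 1 / √((2 : ℝ) ^ n * 2 ^ m) * (norm11 W * traceNorm X * 2 ^ m) := by gcongr
    _ = _ := by
      rw [Real.sqrt_mul (by positivity)]
      have h2 : √((2 : ℝ) ^ m) * √(2 ^ m) = 2 ^ m := Real.mul_self_sqrt (by positivity)
      have h3 : √((2 : ℝ) ^ m) ≠ 0 := by positivity
      have h4 : √((2 : ℝ) ^ n) ≠ 0 := by positivity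
      field_simp
      rw [sq, h2]

end Pauli

/-! ### Propagation of parameter perturbations through the layers. -/

section Perturbation

/-- A discrete Gronwall inequality. -/
lemma le_mul_prod_add_sum {L : ℕ} (a : Fin (L + 1) → ℝ) (s e : Fin L → ℝ) (hs : ∀ j, 0 ≤ s j)
    (h : ∀ j : Fin L, a j.succ ≤ s j * a j.castSucc + e j) :
    a (Fin.last L) ≤ a 0 * ∏ j, s j + ∑ j, e j * ∏ l ∈ Finset.Ioi j, s l := by
  induction L with
  | zero => simp
  | succ L ih =>
    have h1 := ih (fun i => a i.succ) (fun j => s j.succ) (fun j => e j.succ)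
      (fun j => hs _) (fun j => h j.succ)
    have h2 := h 0
    have hp : 0 ≤ ∏ j : Fin L, s j.succ := Finset.prod_nonneg fun j _ => hs _
    rw [Fin.sum_univ_succ, Fin.prod_univ_succ, Fin.prod_Ioi_zero]
    simp_rw [Fin.prod_Ioi_succ]
    have h3 : a (Fin.last (L + 1)) ≤ a (Fin.succ 0) * ∏ j : Fin L, s j.succ
        + ∑ j : Fin L, e j.succ * ∏ l ∈ Finset.Ioi j, s l.succ := h1
    have h4 : a (Fin.succ 0) * ∏ j : Fin L, s j.succ
        ≤ (s 0 * a 0 + e 0) * ∏ j : Fin L, s j.succ := mul_le_mul_of_nonneg_right h2 hp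
    linarith

variable {L : ℕ} {n : Fin (L + 1) → ℕ}

/-- The state of a re-uploading model after the first `i` layers. -/
def reuploadState (φ : ∀ j : Fin L, Op (n j.castSucc) →ₗ[ℂ] Op (n j.succ))
    (E : ∀ j : Fin L, Op (n j.castSucc) →ₗ[ℂ] Op (n j.castSucc))
    (ρ₀ : Op (n 0)) (i : Fin (L + 1)) : Op (n i) :=
  Fin.induction (motive := fun j => Op (n j)) ρ₀ (fun j ρ => φ j (E j ρ)) i

lemma reuploadState_succ (φ : ∀ j : Fin L, Op (n j.castSucc) →ₗ[ℂ] Op (n j.succ))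
    (E : ∀ j : Fin L, Op (n j.castSucc) →ₗ[ℂ] Op (n j.castSucc)) (ρ₀ : Op (n 0)) (j : Fin L) :
    reuploadState φ E ρ₀ j.succ = φ j (E j (reuploadState φ E ρ₀ j.castSucc)) :=
  Fin.induction_succ _ _ _

lemma isState_reuploadState {φ : ∀ j : Fin L, Op (n j.castSucc) →ₗ[ℂ] Op (n j.succ)}
    {E : ∀ j : Fin L, Op (n j.castSucc) →ₗ[ℂ] Op (n j.castSucc)} {ρ₀ : Op (n 0)}
    (hφ : ∀ j, IsChannel (φ j)) (hE : ∀ j, IsChannel (E j)) (hρ : IsState ρ₀) (i : Fin (L + 1)) :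
    IsState (reuploadState φ E ρ₀ i) := by
  induction i using Fin.induction with
  | zero => exact hρ
  | succ j ih =>
    rw [reuploadState_succ]
    exact (hφ j).isState_map ((hE j).isState_map ih)

/-- If each layer is the sum of the completely depolarizing channel and a deviation, then the
difference of the final states of two models is controlled by the differences of the layers. -/
lemma traceNorm_reuploadState_sub_le
    {φ φ' : ∀ j : Fin L, Op (n j.castSucc) →ₗ[ℂ] Op (n j.succ)}
    {E : ∀ j : Fin L, Op (n j.castSucc) →ₗ[ℂ] Op (n j.castSucc)} {ρ₀ : Op (n 0)}
    (hφ : ∀ j, IsChannel (φ j)) (hφ' : ∀ j, IsChannel (φ' j)) (hE : ∀ j, IsChannel (E j))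
    (hρ : IsState ρ₀) {r : Fin (L + 1) → ℝ} (hr : ∀ i, 0 < r i) {c : Fin L → ℝ} {τ : ℝ}
    (hc : ∀ j, 0 ≤ c j) (hτ : 0 ≤ τ)
    (hdev : ∀ j X, X.trace = 0 → traceNorm (φ j X) ≤ r j.succ / r j.castSucc * (c j * traceNorm X))
    (hsub : ∀ j X, traceNorm (φ j X - φ' j X) ≤ r j.succ / r j.castSucc * (τ * traceNorm X)) :
    traceNorm (reuploadState φ E ρ₀ (Fin.last L) - reuploadState φ' E ρ₀ (Fin.last L)) ≤
      r (Fin.last L) * (∑ j : Fin L, 1 / r j.castSucc * ∏ l ∈ Finset.Ioi j, c l) * τ := by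
  set ρ := reuploadState φ E ρ₀
  set ρ' := reuploadState φ' E ρ₀
  have hs : ∀ i, IsState (ρ i) := isState_reuploadState hφ hE hρ
  have hs' : ∀ i, IsState (ρ' i) := isState_reuploadState hφ' hE hρ
  -- Dividing by `r` makes the ratios `r j.succ / r j.castSucc` telescope, leaving a recursion with
  -- factors `c j`.
  have hstep : ∀ j : Fin L, traceNorm (ρ j.succ - ρ' j.succ) / r j.succ ≤
      c j * (traceNorm (ρ j.castSucc - ρ' j.castSucc) / r j.castSucc)
        + τ * (1 / r j.castSucc) := by
    intro j
    -- One layer on two states, whose difference is traceless, plus two layers on one state.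
    have h1 : ρ j.succ - ρ' j.succ = φ j (E j (ρ j.castSucc - ρ' j.castSucc))
        + (φ j (E j (ρ' j.castSucc)) - φ' j (E j (ρ' j.castSucc))) := by
      simp only [ρ, ρ', reuploadState_succ, map_sub]; abel
    have h2 : (E j (ρ j.castSucc - ρ' j.castSucc)).trace = 0 := by
      rw [(hE j).2, Matrix.trace_sub, (hs _).2, (hs' _).2, sub_self]
    have h3 : traceNorm (E j (ρ j.castSucc - ρ' j.castSucc))
        ≤ traceNorm (ρ j.castSucc - ρ' j.castSucc) :=
      (hE j).traceNorm_map_le ((hs _).1.isHermitian.sub (hs' _).1.isHermitian)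
    have h4 : traceNorm (E j (ρ' j.castSucc)) ≤ 1 := ((hE j).isState_map (hs' _)).traceNorm_le_one
    have hr1 := hr j.succ
    have hr2 := hr j.castSucc
    have hcj := hc j
    rw [div_le_iff₀ hr1, h1]
    calc _ ≤ r j.succ / r j.castSucc * (c j * traceNorm (ρ j.castSucc - ρ' j.castSucc))
          + r j.succ / r j.castSucc * (τ * 1) := by
          refine (traceNorm_add_le _ _).trans (add_le_add ?_ ?_)
          · exact (hdev j _ h2).trans (by gcongr)
          · exact (hsub j _).trans (by gcongr)
      _ = _ := by field_simp
  have key := le_mul_prod_add_sum (fun i => traceNorm (ρ i - ρ' i) / r i) c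
    (fun j => τ * (1 / r j.castSucc)) hc hstep
  have h0 : ρ 0 - ρ' 0 = 0 := sub_self ρ₀
  rw [h0, traceNorm_zero, zero_div, zero_mul, zero_add, div_le_iff₀ (hr _)] at key
  refine key.trans_eq ?_
  rw [mul_comm _ (r _), mul_assoc, Finset.sum_mul]
  congr 1
  exact Finset.sum_congr rfl fun j _ => by ring

/-- The multiple of the identity favours no outcome. Applied to the last layer, this shows that a
small deviation there forces small margins. -/
lemma measure_sub_le_of_eq_add {m : ℕ} {ρ Y : Op m} {z : ℂ} (h : ρ = z • (1 : Op m) + Y)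
    (k k' : Basis2 m) : measure ρ k - measure ρ k' ≤ 2 * traceNorm Y := by
  have h1 : measure ρ k - measure ρ k' = measure Y k - measure Y k' := by
    rw [h]; simp [measure_eq_re]
  have h2 := abs_le.mp (abs_measure_le Y k)
  have h3 := abs_le.mp (abs_measure_le Y k')
  rw [h1]; linarith [h2.2, h3.1]

end Perturbation

/-! ### Measurability of predictions in the input. -/

section Measurability

variable {X : Type u} [MeasurableSpace X]

lemma measurable_map_apply {n m : ℕ} {Φ : X → Op n →ₗ[ℂ] Op m}
    (hΦ : ∀ (ρ : Op n) a b, Measurable fun x => Φ x ρ a b) {ρ : X → Op n}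
    (hρ : ∀ a b, Measurable fun x => ρ x a b) (a b : Basis2 m) :
    Measurable fun x => Φ x (ρ x) a b := by
  have h : ∀ x, Φ x (ρ x) a b = ∑ c, ∑ d, ρ x c d * Φ x (Matrix.single c d 1) a b := by
    intro x
    conv_lhs => rw [Matrix.matrix_eq_sum_single (ρ x)]
    simp only [map_sum, Matrix.sum_apply]
    refine Finset.sum_congr rfl fun c _ => Finset.sum_congr rfl fun d _ => ?_
    rw [← mul_one (ρ x c d), ← smul_eq_mul, ← Matrix.smul_single, map_smul]
    simp
  simp_rw [h]
  exact Finset.measurable_sum _ fun c _ => Finset.measurable_sum _ fun d _ =>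
    (hρ c d).mul (hΦ _ a b)

lemma measurable_reuploadState {L : ℕ} {n : Fin (L + 1) → ℕ}
    (φ : ∀ j : Fin L, Op (n j.castSucc) →ₗ[ℂ] Op (n j.succ))
    {E : ∀ j : Fin L, X → Op (n j.castSucc) →ₗ[ℂ] Op (n j.castSucc)}
    (hE : ∀ j, IsEncoding (E j)) (ρ₀ : Op (n 0)) (i : Fin (L + 1)) (a b : Basis2 (n i)) :
    Measurable fun x => reuploadState φ (fun j => E j x) ρ₀ i a b := by
  induction i using Fin.induction with
  | zero => exact measurable_const
  | succ j ih =>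
    simp_rw [reuploadState_succ]
    exact measurable_map_apply (Φ := fun _ => φ j) (fun _ _ _ => measurable_const)
      (measurable_map_apply (hE j).2 ih) a b

end Measurability

/-! ### Summable code weights and the coding of sparse parameters. -/

section Codes

/-- A finite set of tuples lies in the box of its coordinate projections, over which the sum
factors. -/
lemma tsum_pi_prod_le {I : Type*} [Fintype I] {A : I → Type*}
    (w : ∀ i, A i → ENNReal) : ∑' a : ∀ i, A i, ∏ i, w i (a i) ≤ ∏ i, ∑' x, w i x := by
  classical
  rw [ENNReal.tsum_eq_iSup_sum]
  refine iSup_le fun T => ?_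
  let t : ∀ i, Finset (A i) := fun i => T.image fun a => a i
  have hT : T ⊆ Fintype.piFinset t := fun a ha =>
    Fintype.mem_piFinset.mpr fun i => Finset.mem_image_of_mem (fun a : ∀ i, A i => a i) ha
  refine (Finset.sum_le_sum_of_subset hT).trans ?_
  rw [← Finset.prod_univ_sum t w]
  exact Finset.prod_le_prod' fun i _ => ENNReal.sum_le_tsum _

/-- The weight `2 ^ (-|m| - 2)` of an integer. -/
def intWeight (m : ℤ) : ℝ := (1 / 2) ^ (m.natAbs + 2)

lemma intWeight_pos (m : ℤ) : 0 < intWeight m := by unfold intWeight; positivity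

lemma tsum_half_pow (k : ℕ) :
    ∑' i : ℕ, ENNReal.ofReal ((1 / 2 : ℝ) ^ (i + 1 + k)) = ENNReal.ofReal ((1 / 2) ^ k) := by
  have h1 : ∀ i : ℕ, (1 / 2 : ℝ) ^ (i + 1 + k) = (1 / 2) ^ k * (1 / 2 / 2 ^ i) := fun i => by
    rw [pow_add, pow_add, one_div_pow (2 : ℝ) i]; ring
  have h2 : HasSum (fun i : ℕ => (1 / 2 : ℝ) ^ (i + 1 + k)) ((1 / 2) ^ k) := by
    simp_rw [h1]
    simpa using (hasSum_geometric_two' (1 : ℝ)).mul_left ((1 / 2 : ℝ) ^ k)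
  rw [← ENNReal.ofReal_tsum_of_nonneg (fun i => by positivity) h2.summable, h2.tsum_eq]

lemma tsum_intWeight_le : ∑' m : ℤ, ENNReal.ofReal (intWeight m) ≤ 1 := by
  rw [← Equiv.intEquivNatSumNat.symm.tsum_eq, ENNReal.summable.tsum_sum ENNReal.summable]
  have h1 : ∀ i : ℕ, intWeight (Equiv.intEquivNatSumNat.symm (Sum.inl i))
      = (1 / 2 : ℝ) ^ (i + 1 + 1) := fun i => rfl
  have h2 : ∀ i : ℕ, intWeight (Equiv.intEquivNatSumNat.symm (Sum.inr i))
      = (1 / 2 : ℝ) ^ (i + 1 + 2) := fun i => rfl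
  simp_rw [h1, h2]
  rw [tsum_half_pow, tsum_half_pow, ← ENNReal.ofReal_add (by positivity) (by positivity)]
  exact ENNReal.ofReal_le_one.mpr (by norm_num)

/-- Codes of sparse matrix tuples: every layer is either skipped or has integer real and imaginary
parts at the positions of its sparsity pattern. -/
abbrev Code {L : ℕ} {P : Fin L → Type} (S : ∀ j, Finset (P j)) : Type :=
  ∀ j, Option (S j → ℤ × ℤ)

/-- The weight of one layer of a code. -/
def layerWeight (L : ℕ) {T : Type} [Fintype T] : Option (T → ℤ × ℤ) → ℝ
  | none => 1
  | some m => 1 / L * ∏ e, intWeight (m e).1 * intWeight (m e).2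

lemma layerWeight_pos {L : ℕ} (hL : 1 ≤ L) {T : Type} [Fintype T] (o : Option (T → ℤ × ℤ)) :
    0 < layerWeight L o := by
  have : (0 : ℝ) < L := by exact_mod_cast hL
  cases o with
  | none => exact one_pos
  | some m =>
    exact mul_pos (by positivity)
      (Finset.prod_pos fun e _ => mul_pos (intWeight_pos _) (intWeight_pos _))

/-- Skipping has weight `1`, hence no cost. The factor `1 / L` on coded layers limits the excess so
that the product over `L` layers stays bounded. -/
lemma tsum_layerWeight_le (L : ℕ) (T : Type) [Fintype T] :
    ∑' o : Option (T → ℤ × ℤ), ENNReal.ofReal (layerWeight L o) ≤ ENNReal.ofReal (1 + 1 / L) := by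
  have hpair : ∑' x : ℤ × ℤ, ENNReal.ofReal (intWeight x.1 * intWeight x.2) ≤ 1 := by
    simp_rw [ENNReal.ofReal_mul (intWeight_pos _).le]
    rw [ENNReal.tsum_prod' (f := fun x : ℤ × ℤ => ENNReal.ofReal (intWeight x.1) *
      ENNReal.ofReal (intWeight x.2))]
    simp_rw [ENNReal.tsum_mul_left, ENNReal.tsum_mul_right]
    exact mul_le_one' tsum_intWeight_le tsum_intWeight_le
  have hsome : ∑' m : T → ℤ × ℤ, ENNReal.ofReal (layerWeight L (some m))
      ≤ ENNReal.ofReal (1 / L) := by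
    have h : ∀ m : T → ℤ × ℤ, ENNReal.ofReal (layerWeight L (some m))
        = ENNReal.ofReal (1 / L) * ∏ e, ENNReal.ofReal (intWeight (m e).1 * intWeight (m e).2) := by
      intro m
      rw [layerWeight, ENNReal.ofReal_mul (by positivity), ENNReal.ofReal_prod_of_nonneg]
      exact fun e _ => (mul_pos (intWeight_pos _) (intWeight_pos _)).le
    simp_rw [h]
    rw [ENNReal.tsum_mul_left]
    refine mul_le_of_le_one_right' ?_
    refine (tsum_pi_prod_le fun _ : T =>
      fun x : ℤ × ℤ => ENNReal.ofReal (intWeight x.1 * intWeight x.2)).trans ?_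
    exact Finset.prod_le_one' fun _ _ => hpair
  rw [← (Equiv.optionEquivSumPUnit.{0} (T → ℤ × ℤ)).symm.tsum_eq,
    ENNReal.summable.tsum_sum ENNReal.summable]
  simp only [Equiv.optionEquivSumPUnit_symm_inl, Equiv.optionEquivSumPUnit_symm_inr,
    tsum_fintype, Finset.univ_unique, Finset.sum_singleton]
  rw [add_comm (1 : ℝ), ENNReal.ofReal_add (by positivity) zero_le_one]
  exact add_le_add hsome le_rfl

/-- The weight of a scale index and a code. -/
def codeWeight {L : ℕ} {P : Fin L → Type} {S : ∀ j, Finset (P j)} (i : ℕ × Code S) : ℝ :=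
  (1 / 3) * (1 / 2) ^ (i.1 + 1) * ∏ j, layerWeight L (i.2 j)

lemma codeWeight_pos {L : ℕ} (hL : 1 ≤ L) {P : Fin L → Type} {S : ∀ j, Finset (P j)}
    (i : ℕ × Code S) : 0 < codeWeight i :=
  mul_pos (by positivity) (Finset.prod_pos fun _ _ => layerWeight_pos hL _)

/-- The layers contribute at most `(1 + 1 / L) ^ L ≤ e ≤ 3`, compensated by the factor `1 / 3`; the
scale indices form a geometric series of sum `1`. -/
lemma tsum_codeWeight_le {L : ℕ} (hL : 1 ≤ L) {P : Fin L → Type} (S : ∀ j, Finset (P j)) :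
    ∑' i : ℕ × Code S, ENNReal.ofReal (codeWeight i) ≤ 1 := by
  have h : ∀ i : ℕ × Code S, ENNReal.ofReal (codeWeight i) = ENNReal.ofReal (1 / 3) *
      (ENNReal.ofReal ((1 / 2) ^ (i.1 + 1 + 0)) *
        ∏ j, ENNReal.ofReal (layerWeight L (i.2 j))) := by
    intro i
    rw [codeWeight, mul_assoc, ENNReal.ofReal_mul (by positivity),
      ENNReal.ofReal_mul (by positivity), ENNReal.ofReal_prod_of_nonneg]
    exact fun j _ => (layerWeight_pos hL _).le
  simp_rw [h]
  rw [ENNReal.tsum_mul_left, ENNReal.tsum_prod' (f := fun i : ℕ × Code S =>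
    ENNReal.ofReal ((1 / 2) ^ (i.1 + 1 + 0)) * ∏ j, ENNReal.ofReal (layerWeight L (i.2 j)))]
  simp_rw [ENNReal.tsum_mul_left, ENNReal.tsum_mul_right]
  rw [tsum_half_pow]
  have hL0 : (0 : ℝ) < L := by exact_mod_cast hL
  have hprod : ∑' g : Code S, ∏ j, ENNReal.ofReal (layerWeight L (g j)) ≤ ENNReal.ofReal 3 := by
    refine (tsum_pi_prod_le fun j : Fin L =>
      fun o : Option (S j → ℤ × ℤ) => ENNReal.ofReal (layerWeight L o)).trans ?_
    refine (Finset.prod_le_prod' fun j _ => tsum_layerWeight_le L (S j)).trans ?_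
    rw [Finset.prod_const, Finset.card_univ, Fintype.card_fin, ← ENNReal.ofReal_pow (by positivity)]
    refine ENNReal.ofReal_le_ofReal ?_
    calc (1 + 1 / (L : ℝ)) ^ L ≤ Real.exp (1 / L) ^ L := by
          gcongr; linarith [Real.add_one_le_exp (1 / (L : ℝ))]
      _ = Real.exp 1 := by rw [← Real.exp_nat_mul]; congr 1; field_simp
      _ ≤ 3 := by linarith [Real.exp_one_lt_d9]
  calc _ ≤ ENNReal.ofReal (1 / 3) * (ENNReal.ofReal ((1 / 2) ^ 0) * ENNReal.ofReal 3) := by gcongr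
    _ = 1 := by
      rw [← ENNReal.ofReal_mul (by positivity), ← ENNReal.ofReal_mul (by positivity)]; norm_num

/-- The integer part, rounded towards zero. -/
def truncZero (x : ℝ) : ℤ := if 0 ≤ x then ⌊x⌋ else ⌈x⌉

lemma abs_sub_truncZero_le (x : ℝ) : |x - truncZero x| ≤ 1 := by
  unfold truncZero
  split_ifs with h
  · rw [abs_le]; constructor <;> linarith [Int.floor_le x, Int.lt_floor_add_one x]
  · rw [abs_le]; constructor <;> linarith [Int.le_ceil x, Int.ceil_lt_add_one x]

/-- Rounding towards zero gives `|m| ≤ |x|`, and `|m| ≤ m ^ 2` for integers. The quadratic bound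
lets code lengths be charged to the Frobenius norm. -/
lemma natAbs_truncZero_le (x : ℝ) : ((truncZero x).natAbs : ℝ) ≤ x ^ 2 := by
  have h1 : |(truncZero x : ℝ)| ≤ |x| := by
    unfold truncZero
    split_ifs with h
    · rw [abs_of_nonneg h, abs_of_nonneg (by exact_mod_cast Int.floor_nonneg.mpr h)]
      exact Int.floor_le x
    · have h' := (not_le.mp h).le
      rw [abs_of_nonpos h', abs_of_nonpos (by exact_mod_cast Int.ceil_nonpos.mpr h')]
      linarith [Int.le_ceil x]
  have h2 : ((truncZero x).natAbs : ℝ) = |(truncZero x : ℝ)| := by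
    rw [Nat.cast_natAbs, Int.cast_abs]
  have h3 : ((truncZero x).natAbs : ℝ) ≤ ((truncZero x).natAbs : ℝ) ^ 2 := by
    exact_mod_cast Nat.le_self_pow two_ne_zero _
  calc _ ≤ ((truncZero x).natAbs : ℝ) ^ 2 := h3
    _ ≤ |x| ^ 2 := by rw [h2]; gcongr
    _ = x ^ 2 := sq_abs x

lemma neg_log_intWeight (m : ℤ) : -Real.log (intWeight m) = (m.natAbs + 2) * Real.log 2 := by
  rw [intWeight, Real.log_pow, one_div, Real.log_inv]; push_cast; ring

section Encoding

variable {𝕜 : Type} [RCLike 𝕜]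

lemma norm_le_abs_re_add_abs_im (z : 𝕜) : ‖z‖ ≤ |RCLike.re z| + |RCLike.im z| := by
  refine abs_le_of_sq_le_sq' ?_ (by positivity) |>.2
  rw [← RCLike.normSq_eq_def', RCLike.normSq_apply, add_sq, sq_abs, sq_abs]
  have : 0 ≤ 2 * |RCLike.re z| * |RCLike.im z| := by positivity
  linarith

lemma SupportedOn.sub {α β : Type} {W W' : Matrix α β 𝕜} {S : Finset (α × β)}
    (h : SupportedOn W S) (h' : SupportedOn W' S) : SupportedOn (W - W') S := fun a b hab => by
  rw [Matrix.sub_apply, h a b hab, h' a b hab, sub_zero]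

section OneLayer

variable {α β : Type} [Fintype α] [Fintype β]

lemma SupportedOn.norm11_eq_sum {W : Matrix α β 𝕜} {S : Finset (α × β)} (h : SupportedOn W S) :
    norm11 W = ∑ e : S, ‖W e.1.1 e.1.2‖ := by
  rw [norm11, ← Fintype.sum_prod_type' (f := fun a b => ‖W a b‖),
    Finset.sum_coe_sort S fun e => ‖W e.1 e.2‖]
  symm
  refine Finset.sum_subset (Finset.subset_univ S) fun e _ he => ?_
  rw [h e.1 e.2 he, norm_zero]

lemma SupportedOn.frobSq_eq_sum {W : Matrix α β 𝕜} {S : Finset (α × β)} (h : SupportedOn W S) :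
    frobSq W = ∑ e : S, ‖W e.1.1 e.1.2‖ ^ 2 := by
  rw [frobSq, ← Fintype.sum_prod_type' (f := fun a b => ‖W a b‖ ^ 2),
    Finset.sum_coe_sort S fun e => ‖W e.1 e.2‖ ^ 2]
  symm
  refine Finset.sum_subset (Finset.subset_univ S) fun e _ he => ?_
  simp [h e.1 e.2 he]

/-- Cauchy–Schwarz over the positions of the pattern. -/
lemma SupportedOn.norm11_sq_le {W : Matrix α β 𝕜} {S : Finset (α × β)} (h : SupportedOn W S) :
    norm11 W ^ 2 ≤ S.card * frobSq W := by
  rw [h.norm11_eq_sum, h.frobSq_eq_sum]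
  simpa using sq_sum_le_card_mul_sum_sq (s := (Finset.univ : Finset S))
    (f := fun e => ‖W e.1.1 e.1.2‖)

lemma frobSq_nonneg (W : Matrix α β 𝕜) : 0 ≤ frobSq W :=
  Finset.sum_nonneg fun _ _ => Finset.sum_nonneg fun _ _ => by positivity

lemma norm11_nonneg (W : Matrix α β 𝕜) : 0 ≤ norm11 W :=
  Finset.sum_nonneg fun _ _ => Finset.sum_nonneg fun _ _ => norm_nonneg _

lemma norm11_sub_le (W W' : Matrix α β 𝕜) : norm11 (W - W') ≤ norm11 W + norm11 W' := by
  simp only [norm11, ← Finset.sum_add_distrib]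
  exact Finset.sum_le_sum fun _ _ => Finset.sum_le_sum fun _ _ => norm_sub_le _ _

open Classical in
/-- The code of a layer: rounding with precision `t` in the entrywise norm. -/
def encodeLayer (ξ : ℕ) (t : ℝ) (S : Finset (α × β)) (W : Matrix α β 𝕜) :
    Option (S → ℤ × ℤ) :=
  if norm11 W ≤ t then none
  else some fun e => (truncZero (ξ / t * RCLike.re (W e.1.1 e.1.2)),
    truncZero (ξ / t * RCLike.im (W e.1.1 e.1.2)))

lemma abs_sub_le_of_truncZero_eq {x y : ℝ} (h : truncZero x = truncZero y) : |x - y| ≤ 2 := by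
  have h1 := abs_le.mp (abs_sub_truncZero_le x)
  have h2 := abs_le.mp (abs_sub_truncZero_le y)
  rw [h] at h1
  rw [abs_le]; constructor <;> linarith [h1.1, h1.2, h2.1, h2.2]

/-- Two skipped layers differ by at most `2 * t`. Otherwise real and imaginary parts each differ by
at most two mesh widths `t / ξ`, at no more than `ξ` positions. -/
lemma norm11_sub_le_of_encodeLayer_eq {ξ : ℕ} {t : ℝ} (ht : 0 < t) {S : Finset (α × β)}
    (hξ : S.card ≤ ξ) {W W' : Matrix α β 𝕜} (h : SupportedOn W S) (h' : SupportedOn W' S)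
    (hc : encodeLayer ξ t S W = encodeLayer ξ t S W') : norm11 (W - W') ≤ 4 * t := by
  unfold encodeLayer at hc
  split_ifs at hc with h1 h2 h2
  · linarith [norm11_sub_le W W']
  · rw [Option.some_inj] at hc
    have hterm : ∀ e : S, ξ * ‖(W - W') e.1.1 e.1.2‖ ≤ 4 * t := by
      intro e
      have he := congrFun hc e
      rw [Prod.mk.injEq] at he
      have hre := abs_sub_le_of_truncZero_eq he.1
      have him := abs_sub_le_of_truncZero_eq he.2
      rw [← mul_sub, ← map_sub, abs_mul, abs_of_nonneg (by positivity), div_mul_eq_mul_div,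
        div_le_iff₀ ht] at hre him
      calc ξ * ‖(W - W') e.1.1 e.1.2‖ ≤ ξ * (|RCLike.re ((W - W') e.1.1 e.1.2)| +
            |RCLike.im ((W - W') e.1.1 e.1.2)|) := by
            gcongr; exact norm_le_abs_re_add_abs_im _
        _ ≤ 4 * t := by simp only [Matrix.sub_apply]; linarith
    rw [(h.sub h').norm11_eq_sum]
    rcases Nat.eq_zero_or_pos ξ with h0 | h0
    · have : IsEmpty S := by
        rw [← Fintype.card_eq_zero_iff, Fintype.card_coe]; omega
      simp; linarith
    · have hξ0 : (0 : ℝ) < ξ := by exact_mod_cast h0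
      have : ξ * ∑ e : S, ‖(W - W') e.1.1 e.1.2‖ ≤ ξ * (4 * t) := by
        rw [Finset.mul_sum]
        refine (Finset.sum_le_sum fun e _ => hterm e).trans ?_
        rw [Finset.sum_const, Finset.card_univ, Fintype.card_coe, nsmul_eq_mul]
        gcongr
      exact le_of_mul_le_mul_left this hξ0

/-- A coded layer has `norm11 > t`, hence `1 ≤ ξ * frobSq W / t ^ 2`, so fixed costs can be charged
to this quantity. The constant is `6 = 1 + 4 + 1`: naming the layer (`log L`), the four fixed bits
per position, and the sizes of the integers. -/
lemma neg_log_layerWeight_encodeLayer_le {L : ℕ} (hL : 1 ≤ L) {ξ : ℕ} {t Λ : ℝ} (ht : 0 < t)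
    {S : Finset (α × β)} (hξ : S.card ≤ ξ) (hΛL : Real.log L ≤ Λ) (hΛξ : ξ * Real.log 2 ≤ Λ)
    {W : Matrix α β 𝕜} (h : SupportedOn W S) :
    -Real.log (layerWeight L (encodeLayer ξ t S W)) ≤ 6 * (ξ * Λ * frobSq W / t ^ 2) := by
  have hlog2 : 0 < Real.log 2 := Real.log_pos one_lt_two
  have hΛ0 : 0 ≤ Λ := le_trans (by positivity) hΛξ
  have hF := frobSq_nonneg W
  have hL0 : (0 : ℝ) < L := by exact_mod_cast hL
  unfold encodeLayer
  split_ifs with h1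
  · simp only [layerWeight, Real.log_one, neg_zero]; positivity
  · have hone : 1 ≤ ξ * frobSq W / t ^ 2 := by
      rw [le_div_iff₀ (by positivity), one_mul]
      calc t ^ 2 ≤ norm11 W ^ 2 := by gcongr; exact (not_le.mp h1).le
        _ ≤ S.card * frobSq W := h.norm11_sq_le
        _ ≤ ξ * frobSq W := by gcongr
    simp only [layerWeight]
    rw [Real.log_mul (by positivity) (Finset.prod_ne_zero_iff.mpr fun e _ =>
      (mul_pos (intWeight_pos _) (intWeight_pos _)).ne'), Real.log_prod (fun e _ =>
      (mul_pos (intWeight_pos _) (intWeight_pos _)).ne'), one_div, Real.log_inv]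
    have hent : ∀ e : S, -Real.log (intWeight (truncZero (ξ / t * RCLike.re (W e.1.1 e.1.2))) *
        intWeight (truncZero (ξ / t * RCLike.im (W e.1.1 e.1.2))))
        ≤ 4 * Real.log 2 + (ξ / t) ^ 2 * ‖W e.1.1 e.1.2‖ ^ 2 * Real.log 2 := by
      intro e
      rw [Real.log_mul (intWeight_pos _).ne' (intWeight_pos _).ne', neg_add, neg_log_intWeight,
        neg_log_intWeight]
      have h2 := natAbs_truncZero_le (ξ / t * RCLike.re (W e.1.1 e.1.2))
      have h3 := natAbs_truncZero_le (ξ / t * RCLike.im (W e.1.1 e.1.2))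
      have h4 : ‖W e.1.1 e.1.2‖ ^ 2 = RCLike.re (W e.1.1 e.1.2) ^ 2
          + RCLike.im (W e.1.1 e.1.2) ^ 2 := by rw [← RCLike.normSq_eq_def', RCLike.normSq_apply]; ring
      calc _ = 4 * Real.log 2 + (((truncZero (ξ / t * RCLike.re (W e.1.1 e.1.2))).natAbs : ℝ) +
            (truncZero (ξ / t * RCLike.im (W e.1.1 e.1.2))).natAbs) * Real.log 2 := by ring
        _ ≤ 4 * Real.log 2 + ((ξ / t * RCLike.re (W e.1.1 e.1.2)) ^ 2 +
            (ξ / t * RCLike.im (W e.1.1 e.1.2)) ^ 2) * Real.log 2 := by gcongr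
        _ = _ := by rw [h4]; ring
    have hsum : -∑ e : S, Real.log (intWeight (truncZero (ξ / t * RCLike.re (W e.1.1 e.1.2))) *
        intWeight (truncZero (ξ / t * RCLike.im (W e.1.1 e.1.2))))
        ≤ 4 * Λ + ξ * frobSq W / t ^ 2 * Λ := by
      rw [← Finset.sum_neg_distrib]
      refine (Finset.sum_le_sum fun e _ => hent e).trans ?_
      rw [Finset.sum_add_distrib, Finset.sum_const, ← Finset.sum_mul, ← Finset.mul_sum,
        ← h.frobSq_eq_sum, Finset.card_univ, Fintype.card_coe, nsmul_eq_mul]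
      have h5 : (S.card : ℝ) * (4 * Real.log 2) ≤ 4 * Λ := by
        have : (S.card : ℝ) * Real.log 2 ≤ ξ * Real.log 2 := by gcongr
        linarith
      have h6 : (ξ / t) ^ 2 * frobSq W * Real.log 2 = ξ * frobSq W / t ^ 2 * (ξ * Real.log 2) := by
        ring
      rw [h6]
      gcongr
    calc _ = Real.log L + -∑ e : S, Real.log
          (intWeight (truncZero (ξ / t * RCLike.re (W e.1.1 e.1.2))) *
            intWeight (truncZero (ξ / t * RCLike.im (W e.1.1 e.1.2)))) := by ring
      _ ≤ Λ * (ξ * frobSq W / t ^ 2) + (4 * Λ * (ξ * frobSq W / t ^ 2)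
          + ξ * frobSq W / t ^ 2 * Λ) := by
          have h7 : Λ ≤ Λ * (ξ * frobSq W / t ^ 2) := le_mul_of_one_le_right hΛ0 hone
          linarith
      _ = _ := by ring

end OneLayer

variable {L : ℕ} {α β : Fin L → Type} [∀ j, Fintype (α j)] [∀ j, Fintype (β j)]

/-- The code of a tuple of layers. -/
def encode (ξ : ℕ) (t : ℝ) (S : ∀ j, Finset (α j × β j)) (W : ∀ j, Matrix (α j) (β j) 𝕜) :
    Code S := fun j => encodeLayer ξ t (S j) (W j)

/-- The logarithm in the complexity pays both for naming a layer and for a bit per position. -/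
lemma log_sum_two_pow_ge (hL : 1 ≤ L) (ξ : Fin L → ℕ) :
    Real.log L ≤ Real.log (∑ j, (2 : ℝ) ^ ξ j) ∧
      xiMax ξ * Real.log 2 ≤ Real.log (∑ j, (2 : ℝ) ^ ξ j) := by
  have hL0 : (0 : ℝ) < L := by exact_mod_cast hL
  constructor
  · refine Real.log_le_log hL0 ?_
    calc (L : ℝ) = ∑ _j : Fin L, (1 : ℝ) := by simp
      _ ≤ _ := Finset.sum_le_sum fun j _ => one_le_pow₀ one_le_two
  · have : Nonempty (Fin L) := ⟨⟨0, hL⟩⟩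
    obtain ⟨j, -, hj⟩ := Finset.exists_mem_eq_sup Finset.univ Finset.univ_nonempty ξ
    rw [xiMax, hj, ← Real.log_pow]
    refine Real.log_le_log (by positivity) ?_
    exact Finset.single_le_sum (f := fun j => (2 : ℝ) ^ ξ j) (fun _ _ => by positivity)
      (Finset.mem_univ j)

lemma card_le_xiMax (ξ : Fin L → ℕ) (j : Fin L) : ξ j ≤ xiMax ξ :=
  Finset.le_sup (f := ξ) (Finset.mem_univ j)

lemma neg_log_codeWeight_encode_le (hL : 1 ≤ L) (k : ℕ) {t : ℝ} (ht : 0 < t)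
    {S : ∀ j, Finset (α j × β j)} {W : ∀ j, Matrix (α j) (β j) 𝕜}
    (h : ∀ j, SupportedOn (W j) (S j)) :
    -Real.log (codeWeight (k, encode (xiMax fun j => (S j).card) t S W)) ≤
      2 + Real.log (2 ^ (k + 1)) + 6 * (xiMax (fun j => (S j).card) *
        Real.log (∑ j, (2 : ℝ) ^ (S j).card) * (∑ j, frobSq (W j)) / t ^ 2) := by
  obtain ⟨hΛL, hΛξ⟩ := log_sum_two_pow_ge hL fun j => (S j).card
  rw [codeWeight, Real.log_mul (by positivity)
    (Finset.prod_ne_zero_iff.mpr fun j _ => (layerWeight_pos hL _).ne'),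
    Real.log_mul (by positivity) (by positivity),
    Real.log_prod fun j _ => (layerWeight_pos hL _).ne', one_div_pow, one_div, one_div,
    Real.log_inv, Real.log_inv]
  have h3 : Real.log 3 ≤ 2 := by
    have := Real.log_le_sub_one_of_pos (show (0 : ℝ) < 3 by norm_num)
    linarith
  have hsum : -∑ j, Real.log (layerWeight L (encodeLayer (xiMax fun j => (S j).card) t (S j) (W j)))
      ≤ 6 * (xiMax (fun j => (S j).card) *
        Real.log (∑ j, (2 : ℝ) ^ (S j).card) * (∑ j, frobSq (W j)) / t ^ 2) := by
    rw [← Finset.sum_neg_distrib]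
    refine (Finset.sum_le_sum fun j _ => neg_log_layerWeight_encodeLayer_le hL ht
      (card_le_xiMax (fun j => (S j).card) j) hΛL hΛξ (h j)).trans_eq ?_
    rw [← Finset.mul_sum, ← Finset.sum_div, ← Finset.mul_sum]
  simp only [encode]
  linarith

end Encoding

end Codes

/-! ### Hoeffding's inequality and the weighted union bound. -/

section Concentration

open ProbabilityTheory

variable {Z : Type*} [MeasurableSpace Z] (D : Measure Z) [IsProbabilityMeasure D] {N : ℕ}

open Classical in
/-- The fraction of a sample that lies in a set. -/
def empiricalFreq (A : Set Z) (s : Fin N → Z) : ℝ := (∑ k, if s k ∈ A then (1 : ℝ) else 0) / N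

lemma measurable_empiricalFreq {A : Set Z} (hA : MeasurableSet A) :
    Measurable (empiricalFreq (N := N) A) := by
  unfold empiricalFreq
  refine (Finset.measurable_sum _ fun k _ => ?_).div_const _
  exact Measurable.ite (measurable_pi_apply k hA) measurable_const measurable_const

lemma measureReal_empiricalFreq_add_le (hN : 1 ≤ N) {A : Set Z} (hA : MeasurableSet A) {ε : ℝ}
    (hε : 0 ≤ ε) :
    (Measure.pi fun _ : Fin N => D).real {s | empiricalFreq A s + ε ≤ D.real A} ≤
      Real.exp (-2 * N * ε ^ 2) := by
  classical
  have hN0 : (0 : ℝ) < N := by exact_mod_cast hN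
  -- The sign turns the lower tail of the frequency into an upper tail; values in `[-1, 0]` give the
  -- sub-Gaussian parameter `1 / 4`.
  set f : Z → ℝ := fun z => if z ∈ A then -1 else 0 with hf
  have hfm : Measurable f := Measurable.ite hA measurable_const measurable_const
  have hint : ∀ k, ∫ s, f (s k) ∂(Measure.pi fun _ : Fin N => D) = -D.real A := by
    intro k
    have h := integral_map (μ := Measure.pi fun _ : Fin N => D) (φ := fun s => s k)
      (measurable_pi_apply k).aemeasurable (f := f) hfm.aestronglyMeasurable
    rw [(measurePreserving_eval (fun _ : Fin N => D) k).map_eq] at h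
    rw [← h]
    have h2 : f = fun z => -A.indicator 1 z := by
      ext z; by_cases hz : z ∈ A <;> simp [hf, hz]
    rw [h2, integral_neg, integral_indicator_one hA]
  have hind : iIndepFun (fun (k : Fin N) (s : Fin N → Z) => f (s k) - -D.real A)
      (Measure.pi fun _ : Fin N => D) :=
    iIndepFun_pi (X := fun _ z => f z - -D.real A) fun k => (hfm.sub_const _).aemeasurable
  have hsub : ∀ k ∈ (Finset.univ : Finset (Fin N)),
      HasSubgaussianMGF (fun s : Fin N → Z => f (s k) - -D.real A) ((‖(0 : ℝ) - -1‖₊ / 2) ^ 2)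
        (Measure.pi fun _ : Fin N => D) := by
    intro k _
    rw [← hint k]
    refine hasSubgaussianMGF_of_mem_Icc (hfm.comp (measurable_pi_apply k)).aemeasurable ?_
    refine Filter.Eventually.of_forall fun s => ?_
    by_cases hz : s k ∈ A <;> simp [hf, hz]
  have key := HasSubgaussianMGF.measure_sum_ge_le_of_iIndepFun hind hsub
    (ε := N * ε) (by positivity)
  have hset : {s : Fin N → Z | empiricalFreq A s + ε ≤ D.real A}
      ⊆ {s | N * ε ≤ ∑ k, (f (s k) - -D.real A)} := by
    intro s hs
    simp only [Set.mem_ofPred_eq, empiricalFreq] at hs ⊢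
    have h1 : ∑ k, f (s k) = -∑ k, if s k ∈ A then (1 : ℝ) else 0 := by
      rw [← Finset.sum_neg_distrib]
      exact Finset.sum_congr rfl fun k _ => by by_cases hz : s k ∈ A <;> simp [hf, hz]
    rw [Finset.sum_sub_distrib, h1, Finset.sum_const, Finset.card_univ, Fintype.card_fin,
      nsmul_eq_mul]
    have h2 : (∑ k, if s k ∈ A then (1 : ℝ) else 0) ≤ (D.real A - ε) * N := by
      rw [← div_le_iff₀ hN0]; linarith
    linarith
  refine (measureReal_mono hset).trans (key.trans_eq ?_)
  congr 1
  simp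
  field_simp

/-- The deviation allowed for `A i` is the one for which Hoeffding's bound equals `w i * δ`; these
failure probabilities sum to at most `δ`. -/
lemma exists_uniform_event (hN : 1 ≤ N) {I : Type*} [Countable I] {A : I → Set Z}
    (hA : ∀ i, MeasurableSet (A i)) {w : I → ℝ} (hw : ∀ i, 0 < w i)
    (hsum : ∑' i, ENNReal.ofReal (w i) ≤ 1) {δ : ℝ} (hδ : 0 < δ) (hδ1 : δ < 1) :
    ∃ G : Set (Fin N → Z), MeasurableSet G ∧
      ENNReal.ofReal (1 - δ) ≤ Measure.pi (fun _ : Fin N => D) G ∧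
      ∀ s ∈ G, ∀ i, D.real (A i) ≤
        empiricalFreq (A i) s + √((-Real.log (w i) - Real.log δ) / (2 * N)) := by
  have hN0 : (0 : ℝ) < N := by exact_mod_cast hN
  set ε : I → ℝ := fun i => √((-Real.log (w i) - Real.log δ) / (2 * N)) with hεdef
  set B : I → Set (Fin N → Z) := fun i => {s | empiricalFreq (A i) s + ε i ≤ D.real (A i)}
  have hB : ∀ i, MeasurableSet (B i) := fun i =>
    measurableSet_le ((measurable_empiricalFreq (hA i)).add_const _) measurable_const
  have hw1 : ∀ i, w i ≤ 1 := fun i =>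
    ENNReal.ofReal_le_one.mp ((ENNReal.le_tsum i).trans hsum)
  have hBle : ∀ i, Measure.pi (fun _ : Fin N => D) (B i) ≤ ENNReal.ofReal (w i) *
      ENNReal.ofReal δ := by
    intro i
    have h1 := measureReal_empiricalFreq_add_le D hN (hA i) (Real.sqrt_nonneg _ : 0 ≤ ε i)
    have h2 : -2 * N * ε i ^ 2 = Real.log (w i * δ) := by
      have h3 : Real.log (w i) ≤ 0 := Real.log_nonpos (hw i).le (hw1 i)
      have h4 : Real.log δ ≤ 0 := Real.log_nonpos hδ.le hδ1.le
      rw [hεdef]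
      simp only
      rw [Real.sq_sqrt (div_nonneg (by linarith) (by positivity)),
        Real.log_mul (hw i).ne' hδ.ne']
      field_simp
      ring
    rw [h2, Real.exp_log (mul_pos (hw i) hδ)] at h1
    rw [← ENNReal.ofReal_mul (hw i).le, ← ofReal_measureReal]
    exact ENNReal.ofReal_le_ofReal h1
  refine ⟨(⋃ i, B i)ᶜ, (MeasurableSet.iUnion hB).compl, ?_, ?_⟩
  · rw [prob_compl_eq_one_sub (MeasurableSet.iUnion hB), ENNReal.ofReal_sub _ hδ.le,
      ENNReal.ofReal_one]
    refine tsub_le_tsub_left ?_ _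
    calc _ ≤ ∑' i, Measure.pi (fun _ : Fin N => D) (B i) := measure_iUnion_le _
      _ ≤ ∑' i, ENNReal.ofReal (w i) * ENNReal.ofReal δ := ENNReal.tsum_le_tsum hBle
      _ ≤ 1 * ENNReal.ofReal δ := by rw [ENNReal.tsum_mul_right]; gcongr
      _ = ENNReal.ofReal δ := one_mul _
  · intro s hs i
    have : s ∉ B i := fun h => hs (Set.mem_iUnion.mpr ⟨i, h⟩)
    exact (not_le.mp this).le

end Concentration

/-! ### Margin errors under perturbation of the scores. -/

section Margins

variable {Y : Type} [Finite Y]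

lemma MarginError.of_le_sub [Nontrivial Y] {γ : ℝ} {v : Y → ℝ} {y : Y}
    (h : ∀ k, v y - v k ≤ γ) : MarginError γ v y := by
  obtain ⟨k, hk⟩ := exists_ne y
  have := le_ciSup (f := fun k : {k : Y // k ≠ y} => v k) (Set.finite_range _).bddAbove ⟨k, hk⟩
  have h' := h k
  unfold MarginError
  simp only at this
  linarith

/-- The score of the label and the best competing score each move by at most `τ`. -/
lemma MarginError.mono_of_abs_sub_le {γ γ' τ : ℝ} {v v' : Y → ℝ} {y : Y}
    (h : MarginError γ v y) (hv : ∀ k, |v k - v' k| ≤ τ) (hγ : γ + 2 * τ ≤ γ') :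
    MarginError γ' v' y := by
  unfold MarginError at *
  have h1 : (⨆ k : {k : Y // k ≠ y}, v k) ≤ (⨆ k : {k : Y // k ≠ y}, v' k) + τ := by
    have hτ : 0 ≤ τ := (abs_nonneg _).trans (hv y)
    rcases isEmpty_or_nonempty {k : Y // k ≠ y} with he | he
    · simp [Real.iSup_of_isEmpty, hτ]
    · refine ciSup_le fun k => ?_
      have h2 := le_ciSup (f := fun k : {k : Y // k ≠ y} => v' k) (Set.finite_range _).bddAbove k
      linarith [(abs_le.mp (hv k)).2]
  linarith [(abs_le.mp (hv y)).1]

variable {X : Type u} [MeasurableSpace X] [MeasurableSpace Y]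

lemma measurableSet_marginError [MeasurableSingletonClass Y] (γ : ℝ)
    {f : X → Y → ℝ} (hf : ∀ y, Measurable fun x => f x y) :
    MeasurableSet {p : X × Y | MarginError γ (f p.1) p.2} := by
  refine measurableSet_le ?_ (measurable_const.add ?_)
  · exact measurable_from_prod_countable_left fun y => hf y
  · refine measurable_from_prod_countable_left fun y => ?_
    exact Measurable.iSup fun k : {k : Y // k ≠ y} => hf k

lemma empiricalLoss_eq_empiricalFreq {X : Type u} {Y : Type} {N : ℕ}
    (s : Fin N → X × Y) (γ : ℝ) (f : X → Y → ℝ) :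
    empiricalLoss s γ f = empiricalFreq {p : X × Y | MarginError γ (f p.1) p.2} s := rfl

end Margins

/-! ### The abstract margin bound for sparse Lipschitz classes. -/

section MarginBound

lemma expectedLoss_le_one {X : Type u} [MeasurableSpace X] {Y : Type} [MeasurableSpace Y]
    (D : Measure (X × Y)) [IsProbabilityMeasure D] (γ : ℝ) (f : X → Y → ℝ) :
    expectedLoss D γ f ≤ 1 := measureReal_le_one

lemma empiricalLoss_nonneg {X : Type u} {Y : Type} {N : ℕ} (s : Fin N → X × Y) (γ : ℝ)
    (f : X → Y → ℝ) : 0 ≤ empiricalLoss s γ f := by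
  unfold empiricalLoss
  exact div_nonneg (Finset.sum_nonneg fun i _ => by split_ifs <;> norm_num) (Nat.cast_nonneg _)

lemma empiricalLoss_eq_one {X : Type u} {Y : Type} {N : ℕ} (hN : 1 ≤ N) (s : Fin N → X × Y)
    {γ : ℝ} {f : X → Y → ℝ} (h : ∀ x y, MarginError γ (f x) y) : empiricalLoss s γ f = 1 := by
  have hN0 : (N : ℝ) ≠ 0 := by exact_mod_cast (by omega : N ≠ 0)
  simp [empiricalLoss, h, hN0]

lemma empiricalLoss_mono {X : Type u} {Y : Type} {N : ℕ} (s : Fin N → X × Y) {γ γ' : ℝ}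
    {f f' : X → Y → ℝ} (h : ∀ x y, MarginError γ (f x) y → MarginError γ' (f' x) y) :
    empiricalLoss s γ f ≤ empiricalLoss s γ' f' := by
  unfold empiricalLoss
  gcongr with i _
  by_cases h1 : MarginError γ (f (s i).1) (s i).2
  · simp [h1, h _ _ h1]
  · simp only [h1, if_false]; split_ifs <;> norm_num

lemma expectedLoss_mono {X : Type u} [MeasurableSpace X] {Y : Type} [MeasurableSpace Y]
    (D : Measure (X × Y)) [IsProbabilityMeasure D] {γ γ' : ℝ} {f f' : X → Y → ℝ}
    (h : ∀ x y, MarginError γ (f x) y → MarginError γ' (f' x) y) :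
    expectedLoss D γ f ≤ expectedLoss D γ' f' :=
  measureReal_mono fun p hp => h p.1 p.2 hp

/-- If the scaled complexity `100 √T'` is below `1`, then the code length of the weights at the
matching scale is of order `T'`. -/
lemma exists_scale {b κ ξ Λ w γ δ N : ℝ} (hκ : 0 < κ) (hb : κ ≤ b) (hξ : 0 ≤ ξ)
    (hΛ : Real.log 2 ≤ Λ) (hw : 0 ≤ w) (hγ : 0 < γ) (hγ1 : γ ≤ 1) (hδ : 0 < δ) (hδ1 : δ < 1)
    (hN : 1 ≤ N) (hlow : γ ^ 2 ≤ 4 * κ ^ 2 * (ξ * w))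
    (hT : 10000 * ((b ^ 2 * ξ * Λ * w + Real.log (N / δ)) / (γ ^ 2 * N)) < 1) :
    ∃ k : ℕ, b ≤ κ * 2 ^ (k + 1) ∧
      (2 + Real.log (2 ^ (k + 1)) + 6 * (ξ * Λ * w / (γ / (16 * (κ * 2 ^ (k + 1)))) ^ 2)
        - Real.log δ) / (2 * N) ≤
      10000 * ((b ^ 2 * ξ * Λ * w + Real.log (N / δ)) / (γ ^ 2 * N)) := by
  have hb0 : 0 < b := hκ.trans_le hb
  have hl2 : 0.69 ≤ Real.log 2 := by linarith [Real.log_two_gt_d9]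
  have hΛ0 : 0.69 ≤ Λ := hl2.trans hΛ
  have hN0 : 0 < N := by linarith
  -- The dyadic scale `B = κ * 2 ^ (k + 1)` lies between `b` and `2 * b`; it plays the role of a net
  -- for the values of `β`.
  obtain ⟨k, hk1, hk2⟩ := exists_nat_pow_near (x := b / κ) (y := 2)
    ((one_le_div₀ hκ).mpr hb) one_lt_two
  rw [le_div_iff₀ hκ] at hk1
  rw [div_lt_iff₀ hκ] at hk2
  refine ⟨k, by linarith, ?_⟩
  set B := κ * 2 ^ (k + 1) with hB
  have hB0 : 0 < B := by positivity
  have hB2 : B ≤ 2 * b := by rw [hB, pow_succ]; linarith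
  set v := ξ * w with hv
  have hv0 : 0 ≤ v := by positivity
  have hlogN : 0 ≤ Real.log N := Real.log_nonneg hN
  have hlogδ : 0 ≤ -Real.log δ := by linarith [Real.log_neg hδ hδ1]
  have hlogNδ : Real.log (N / δ) = Real.log N - Real.log δ :=
    Real.log_div hN0.ne' hδ.ne'
  have e1 : b ^ 2 * ξ * Λ * w = b ^ 2 * Λ * v := by rw [hv]; ring
  rw [hlogNδ, e1] at hT ⊢
  have hγ2 : 0 < γ ^ 2 := by positivity
  have hT' : 10000 * (b ^ 2 * Λ * v + (Real.log N - Real.log δ)) < γ ^ 2 * N := by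
    rw [mul_div_assoc', div_lt_one (by positivity)] at hT
    exact hT
  have hκb : κ ^ 2 ≤ b ^ 2 := by gcongr
  have hlow' : γ ^ 2 * Λ ≤ 4 * (b ^ 2 * Λ * v) := by
    have : 4 * κ ^ 2 * v ≤ 4 * b ^ 2 * v := by gcongr
    calc γ ^ 2 * Λ ≤ 4 * b ^ 2 * v * Λ := by gcongr; linarith
      _ = _ := by ring
  -- Smallness of the complexity together with `hlow` forces `b ^ 2 / κ ^ 2` well below `N`, so
  -- naming the scale costs no more than the term `log N` already present.
  have hscale : Real.log (2 ^ (k + 1)) ≤ Real.log N := by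
    refine Real.log_le_log (by positivity) ?_
    have h1 : 10000 * (b ^ 2 * Λ * v) < γ ^ 2 * N := by linarith
    have h2 : 10000 * (b ^ 2 * Λ * v) < 4 * κ ^ 2 * v * N :=
      h1.trans_le (by gcongr)
    have hvpos : 0 < v := by
      rcases hv0.eq_or_lt with h | h
      · rw [← h] at hlow; simp at hlow; linarith
      · exact h
    have h3 : 2500 * (b ^ 2 * Λ) < κ ^ 2 * N := by
      have : v * (2500 * (b ^ 2 * Λ)) < v * (κ ^ 2 * N) := by linarith
      exact lt_of_mul_lt_mul_left this hvpos.le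
    have h4 : b ^ 2 * 0.69 ≤ b ^ 2 * Λ := by gcongr
    have h5 : (κ * 2 ^ (k + 1)) ^ 2 ≤ (2 * b) ^ 2 := by rw [← hB]; gcongr
    have h6 : κ ^ 2 * (2 ^ (k + 1)) ^ 2 ≤ κ ^ 2 * N := by
      rw [← mul_pow]; nlinarith [sq_nonneg b]
    have h7 : ((2 : ℝ) ^ (k + 1)) ^ 2 ≤ N := le_of_mul_le_mul_left h6 (by positivity)
    have h8 : (1 : ℝ) ≤ 2 ^ (k + 1) := one_le_pow₀ one_le_two
    nlinarith
  have hcode : ξ * Λ * w / (γ / (16 * B)) ^ 2 ≤ 1024 * (b ^ 2 * Λ * v) / γ ^ 2 := by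
    have h1 : ξ * Λ * w / (γ / (16 * B)) ^ 2 = 256 * B ^ 2 * (Λ * v) / γ ^ 2 := by
      rw [hv]; field_simp; ring
    have h2 : B ^ 2 ≤ (2 * b) ^ 2 := by gcongr
    rw [h1]
    have h3 : 0 ≤ Λ * v := mul_nonneg (by linarith) hv0
    calc 256 * B ^ 2 * (Λ * v) / γ ^ 2 ≤ 256 * (2 * b) ^ 2 * (Λ * v) / γ ^ 2 := by gcongr
      _ = _ := by ring
  set T := b ^ 2 * Λ * v with hTdef
  -- From `hlow'` and `log 2 / 4 > 0.17`; this absorbs the additive constant `2` of the code length.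
  have hTγ : 0.17 ≤ T / γ ^ 2 := by
    rw [le_div_iff₀ hγ2]; nlinarith
  have hfin : 10000 * ((T + (Real.log N - Real.log δ)) / (γ ^ 2 * N))
      = (10000 * (T / γ ^ 2) + 10000 * ((Real.log N - Real.log δ) / γ ^ 2)) / N := by
    field_simp
  rw [hfin, ← div_div, div_le_div_iff_of_pos_right hN0]
  have hle : Real.log N - Real.log δ ≤ (Real.log N - Real.log δ) / γ ^ 2 := by
    rw [le_div_iff₀ hγ2]
    have : γ ^ 2 ≤ 1 := by nlinarith
    nlinarith
  rw [mul_div_assoc 1024] at hcode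
  linarith

variable {𝕜 : Type} [RCLike 𝕜] {X : Type u} [MeasurableSpace X] {Y : Type} [Finite Y]
  [Nontrivial Y] [MeasurableSpace Y] [MeasurableSingletonClass Y]

/-- A margin bound for a class of sparse parameters whose predictions depend on the parameters in
a Lipschitz way, with a parameter-dependent constant `b W`. -/
theorem exists_event_margin_bound {L N : ℕ} (hL : 1 ≤ L) (hN : 1 ≤ N) {α β : Fin L → Type}
    [∀ j, Fintype (α j)] [∀ j, Fintype (β j)] (S : ∀ j, Finset (α j × β j))
    (H : Set (∀ j, Matrix (α j) (β j) 𝕜)) (hH : ∀ W ∈ H, ∀ j, SupportedOn (W j) (S j))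
    (F : (∀ j, Matrix (α j) (β j) 𝕜) → X → Y → ℝ)
    (hmeas : ∀ W ∈ H, ∀ y, Measurable fun x => F W x y)
    (hone : ∀ W ∈ H, ∀ x y y', F W x y - F W x y' ≤ 1)
    (b : (∀ j, Matrix (α j) (β j) 𝕜) → ℝ) {κ : ℝ} (hκ : 0 < κ) (hb : ∀ W ∈ H, κ ≤ b W)
    (hlip : ∀ W ∈ H, ∀ W' ∈ H, ∀ τ, (∀ j, norm11 (W j - W' j) ≤ τ) →
      ∀ x y, |F W x y - F W' x y| ≤ b W * τ)
    (j₀ : Fin L) (hlast : ∀ W ∈ H, ∀ x y y', F W x y - F W x y' ≤ 2 * κ * norm11 (W j₀))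
    (D : Measure (X × Y)) [IsProbabilityMeasure D] {γ δ : ℝ} (hγ : 0 < γ) (hδ : 0 < δ)
    (hδ1 : δ < 1) :
    ∃ G : Set (Fin N → X × Y), MeasurableSet G ∧
      ENNReal.ofReal (1 - δ) ≤ Measure.pi (fun _ : Fin N => D) G ∧
      ∀ s ∈ G, ∀ W ∈ H, expectedLoss D 0 (F W) ≤ empiricalLoss s γ (F W) +
        100 * √((b W ^ 2 * xiMax (fun j => (S j).card) *
          Real.log (∑ j, (2 : ℝ) ^ (S j).card) * (∑ j, frobSq (W j))
            + Real.log (N / δ)) / (γ ^ 2 * N)) := by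
  classical
  set ξ := xiMax fun j => (S j).card with hξ
  set t : ℕ → ℝ := fun k => γ / (16 * (κ * 2 ^ (k + 1))) with ht
  have ht0 : ∀ k, 0 < t k := fun k => by simp only [ht]; positivity
  -- Each code that occurs gets a representative in `H` itself, chosen before the sample, so that
  -- `hlip` compares two admissible parameters; codes that do not occur get the empty event.
  have hrep : ∀ i : ℕ × Code S, ∃ A : Set (X × Y), MeasurableSet A ∧
      ∀ W ∈ H, encode ξ (t i.1) S W = i.2 → ∃ W' ∈ H, encode ξ (t i.1) S W' = i.2 ∧
        A = {p : X × Y | MarginError (γ / 2) (F W' p.1) p.2} := by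
    intro i
    by_cases h : ∃ W ∈ H, encode ξ (t i.1) S W = i.2
    · obtain ⟨W', hW', hc⟩ := h
      exact ⟨_, measurableSet_marginError (γ / 2) (hmeas W' hW'), fun W _ _ => ⟨W', hW', hc, rfl⟩⟩
    · exact ⟨∅, MeasurableSet.empty, fun W hW hc => absurd ⟨W, hW, hc⟩ h⟩
  choose A hA hAW using hrep
  obtain ⟨G, hG, hGD, hGs⟩ := exists_uniform_event D hN hA (codeWeight_pos hL)
    (tsum_codeWeight_le hL S) hδ hδ1
  refine ⟨G, hG, hGD, fun s hs W hW => ?_⟩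
  set Λ := Real.log (∑ j, (2 : ℝ) ^ (S j).card) with hΛ
  set w2 := ∑ j, frobSq (W j) with hw2
  set T := (b W ^ 2 * ξ * Λ * w2 + Real.log (N / δ)) / (γ ^ 2 * N) with hT
  have hsqrt : 0 ≤ 100 * √T := by positivity
  by_cases htriv : ∀ x y, MarginError γ (F W x) y
  · rw [empiricalLoss_eq_one hN s htriv]
    linarith [expectedLoss_le_one D 0 (F W)]
  by_cases hbig : 1 ≤ 10000 * T
  · have h1 : (1 : ℝ) ≤ 100 * √T := by
      have : √(1 / 10000) ≤ √T := Real.sqrt_le_sqrt (by linarith)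
      rw [show (1 / 10000 : ℝ) = (1 / 100) ^ 2 by norm_num, Real.sqrt_sq (by norm_num)] at this
      linarith
    linarith [expectedLoss_le_one D 0 (F W), empiricalLoss_nonneg s γ (F W)]
  have hγ1 : γ ≤ 1 := by
    by_contra h
    exact htriv fun x y => MarginError.of_le_sub fun k => (hone W hW x y k).trans (not_le.mp h).le
  -- Otherwise no margin exceeds `γ` and the empirical loss is `1`. This lower bound on the weights
  -- is what absorbs the constants.
  have hn11 : γ ≤ 2 * κ * norm11 (W j₀) := by
    by_contra h
    exact htriv fun x y =>
      MarginError.of_le_sub fun k => (hlast W hW x y k).trans (not_le.mp h).le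
  have hfrob : norm11 (W j₀) ^ 2 ≤ ξ * w2 := by
    refine (hH W hW j₀).norm11_sq_le.trans ?_
    have h1 : (S j₀).card ≤ ξ := card_le_xiMax (fun j => (S j).card) j₀
    have h2 : frobSq (W j₀) ≤ w2 :=
      Finset.single_le_sum (f := fun j => frobSq (W j)) (fun j _ => frobSq_nonneg _)
        (Finset.mem_univ j₀)
    have h3 := frobSq_nonneg (W j₀)
    gcongr
  have hlow : γ ^ 2 ≤ 4 * κ ^ 2 * (ξ * w2) := by
    calc γ ^ 2 ≤ (2 * κ * norm11 (W j₀)) ^ 2 := by gcongr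
      _ = 4 * κ ^ 2 * norm11 (W j₀) ^ 2 := by ring
      _ ≤ _ := by gcongr
  have hw0 : 0 ≤ w2 := Finset.sum_nonneg fun j _ => frobSq_nonneg _
  have hξ1 : (1 : ℝ) ≤ ξ := by
    rcases Nat.eq_zero_or_pos ξ with h | h
    · rw [h] at hlow; norm_num at hlow; nlinarith
    · exact_mod_cast h
  have hΛ2 : Real.log 2 ≤ Λ := by
    have := (log_sum_two_pow_ge hL fun j => (S j).card).2
    have h2 : 0 < Real.log 2 := Real.log_pos one_lt_two
    rw [← hξ, ← hΛ] at this
    nlinarith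
  obtain ⟨k, hk, hcost⟩ := exists_scale hκ (hb W hW) (by linarith : (0 : ℝ) ≤ ξ) hΛ2 hw0 hγ hγ1
    hδ hδ1 (by exact_mod_cast hN : (1 : ℝ) ≤ N) hlow (not_le.mp hbig)
  obtain ⟨W', hW', hc, hAeq⟩ := hAW (k, encode ξ (t k) S W) W hW rfl
  -- A score change of `γ / 4` moves margins by `γ / 2`, which allows the passage from margin `0`
  -- for `W` to `γ / 2` for `W'` and back to `γ` for `W`.
  have hclose : ∀ x y, |F W x y - F W' x y| ≤ γ / 4 := by
    intro x y
    refine (hlip W hW W' hW' (4 * t k) (fun j => ?_) x y).trans ?_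
    · exact norm11_sub_le_of_encodeLayer_eq (ht0 k) (card_le_xiMax (fun j => (S j).card) j)
        (hH W hW j) (hH W' hW' j) (congrFun hc j).symm
    · calc b W * (4 * t k) ≤ κ * 2 ^ (k + 1) * (4 * t k) := by
            have := (ht0 k).le
            gcongr
        _ = γ / 4 := by simp only [ht]; field_simp; norm_num
  have hev := hGs s hs (k, encode ξ (t k) S W)
  rw [hAeq, ← empiricalLoss_eq_empiricalFreq] at hev
  have h1 : expectedLoss D 0 (F W) ≤ expectedLoss D (γ / 2) (F W') :=
    expectedLoss_mono D fun x y h => h.mono_of_abs_sub_le (hclose x) (by linarith)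
  have h2 : empiricalLoss s (γ / 2) (F W') ≤ empiricalLoss s γ (F W) :=
    empiricalLoss_mono s fun x y h =>
      h.mono_of_abs_sub_le (fun k => by rw [abs_sub_comm]; exact hclose x k) (by linarith)
  have h3 : √((-Real.log (codeWeight (k, encode ξ (t k) S W)) - Real.log δ) / (2 * N))
      ≤ 100 * √T := by
    have h4 := neg_log_codeWeight_encode_le hL k (ht0 k) (hH W hW)
    calc _ ≤ √(10000 * T) := by
          refine Real.sqrt_le_sqrt (le_trans ?_ hcost)
          gcongr
      _ = 100 * √T := by
          rw [Real.sqrt_mul (by norm_num), show (10000 : ℝ) = 100 ^ 2 by norm_num,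
            Real.sqrt_sq (by norm_num)]
  have h5 : expectedLoss D (γ / 2) (F W') ≤ empiricalLoss s (γ / 2) (F W') +
    √((-Real.log (codeWeight (k, encode ξ (t k) S W)) - Real.log δ) / (2 * N)) := hev
  linarith

/-- The net size is at least `1`, whatever the value of `M`. -/
lemma sqrt_le_complexity {L N : ℕ} (hN : 1 ≤ N) (ξ : Fin L → ℕ) {γ δ : ℝ} (hδ : 0 < δ)
    (β w2 M : ℝ) :
    √((β ^ 2 * xiMax ξ * Real.log (∑ j, (2 : ℝ) ^ ξ j) * w2
      + Real.log (N / δ)) / (γ ^ 2 * N)) ≤ complexity N ξ γ δ β w2 M := by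
  have hN0 : (0 : ℝ) < N := by exact_mod_cast hN
  unfold complexity
  have h1 : 1 ≤ netSize L N γ w2 M := le_max_left _ _
  gcongr
  exact le_mul_of_one_le_right hN0.le h1

end MarginBound

/-! ### Lower bounds for the Lipschitz constants, and the two models. -/

section Models

variable {L : ℕ}

/-- The summand of the last layer is an empty product. It supplies `κ`, the unit of the dyadic
scales. -/
lemma le_betaPM (hL : 1 ≤ L) {c : Fin L → ℝ} (hc : ∀ j, 0 ≤ c j) : 1 ≤ betaPM c := by
  obtain ⟨L, rfl⟩ := Nat.exists_eq_add_of_le' hL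
  have h := Finset.single_le_sum (f := fun j => ∏ l ∈ Finset.Ioi j, c l)
    (fun j _ => Finset.prod_nonneg fun l _ => hc l) (Finset.mem_univ (Fin.last L))
  have h0 : Finset.Ioi (Fin.last L) = ∅ := Finset.Ioi_eq_empty.mpr fun a _ => Fin.le_last a
  simpa [h0, betaPM] using h

lemma le_betaPTM {n : Fin (L + 2) → ℕ} {c : Fin (L + 1) → ℝ} (hc : ∀ j, 0 ≤ c j) :
    √((2 : ℝ) ^ n (Fin.last (L + 1))) / √((2 : ℝ) ^ n (Fin.last L).castSucc) ≤ betaPTM n c := by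
  have h := Finset.single_le_sum
    (f := fun j : Fin (L + 1) => 1 / √((2 : ℝ) ^ n j.castSucc) * ∏ l ∈ Finset.Ioi j, c l)
    (fun j _ => mul_nonneg (by positivity) (Finset.prod_nonneg fun l _ => hc l))
    (Finset.mem_univ (Fin.last L))
  have h0 : Finset.Ioi (Fin.last L) = ∅ := Finset.Ioi_eq_empty.mpr fun a _ => Fin.le_last a
  simp only [h0, Finset.prod_empty, mul_one] at h
  rw [betaPTM, div_eq_mul_one_div]
  gcongr

end Models

end QModel

end

theorem mainTheorem4 :
    ∃ c : ℝ, 0 < c ∧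
      -- process matrix layers
      (∀ (X : Type u) [MeasurableSpace X] (n L N : ℕ), 1 ≤ n → 1 ≤ L → 1 ≤ N →
        ∀ (E : Fin L → X → QModel.Op n →ₗ[ℂ] QModel.Op n), (∀ j, QModel.IsEncoding (E j)) →
        ∀ (ρ₀ : QModel.Op n), QModel.IsState ρ₀ →
        ∀ (S : Fin L → Finset (QModel.PauliIdx n × QModel.PauliIdx n))
          (D : Measure (X × QModel.Basis2 n)) [IsProbabilityMeasure D]
          (γ δ : ℝ), 0 < γ → 0 < δ → δ < 1 →
        ∃ G : Set (Fin N → X × QModel.Basis2 n), MeasurableSet G ∧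
          ENNReal.ofReal (1 - δ) ≤ Measure.pi (fun _ : Fin N => D) G ∧
          ∀ s ∈ G, ∀ W : Fin L → Matrix (QModel.PauliIdx n) (QModel.PauliIdx n) ℂ,
            (∀ j, QModel.IsChannel (QModel.pmMap (W j))) →
            (∀ j, QModel.SupportedOn (W j) (S j)) →
            QModel.expectedLoss D 0 (QModel.pmModel E ρ₀ W) ≤
              QModel.empiricalLoss s γ (QModel.pmModel E ρ₀ W) +
                c * QModel.complexity N (fun j => (S j).card) γ δ
                  (QModel.betaPM fun l => QModel.norm11 (W l))
                  (∑ j, QModel.frobSq (W j))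
                  (QModel.boundM n L (QModel.xiMax fun j => (S j).card))) ∧
      -- Pauli transfer matrix layers
      (∀ (X : Type u) [MeasurableSpace X] (L N : ℕ) (n : Fin (L + 1) → ℕ),
        1 ≤ n (Fin.last L) → 1 ≤ L → 1 ≤ N →
        ∀ (E : ∀ j : Fin L, X → QModel.Op (n j.castSucc) →ₗ[ℂ] QModel.Op (n j.castSucc)),
          (∀ j, QModel.IsEncoding (E j)) →
        ∀ (ρ₀ : QModel.Op (n 0)), QModel.IsState ρ₀ →
        ∀ (S : ∀ j : Fin L,
            Finset (QModel.PauliIdx (n j.succ) × QModel.PauliIdx (n j.castSucc)))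
          (D : Measure (X × QModel.Basis2 (n (Fin.last L)))) [IsProbabilityMeasure D]
          (γ δ : ℝ), 0 < γ → 0 < δ → δ < 1 →
        ∃ G : Set (Fin N → X × QModel.Basis2 (n (Fin.last L))), MeasurableSet G ∧
          ENNReal.ofReal (1 - δ) ≤ Measure.pi (fun _ : Fin N => D) G ∧
          ∀ s ∈ G,
          ∀ W : ∀ j : Fin L,
              Matrix (QModel.PauliIdx (n j.succ)) (QModel.PauliIdx (n j.castSucc)) ℝ,
            (∀ j, QModel.IsChannel (QModel.ptmMap (W j))) →
            (∀ j, QModel.SupportedOn (W j) (S j)) →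
            ∀ C : Fin L → ℝ, (∀ l, QModel.norm11 (W l) ≤ C l) →
            QModel.expectedLoss D 0 (QModel.ptmModel n E ρ₀ W) ≤
              QModel.empiricalLoss s γ (QModel.ptmModel n E ρ₀ W) +
                c * QModel.complexity N (fun j => (S j).card) γ δ
                  (QModel.betaPTM n fun l => QModel.norm11 (W l))
                  (∑ j, QModel.frobSq (W j))
                  (QModel.betaPTM n C)) := by
  open QModel in
  refine ⟨100, by norm_num, ?_, ?_⟩
  · intro X _ n L N hn hL hN E hE ρ₀ hρ S D _ γ δ hγ hδ hδ1
    obtain ⟨L, rfl⟩ := Nat.exists_eq_add_of_le' hL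
    -- With at least one qubit there are two labels, as the margin bound requires.
    have : Nonempty (Fin n) := ⟨⟨0, hn⟩⟩
    let H : Set (Fin (L + 1) → Matrix (PauliIdx n) (PauliIdx n) ℂ) :=
      {W | (∀ j, IsChannel (pmMap (W j))) ∧ ∀ j, SupportedOn (W j) (S j)}
    have hst : ∀ W ∈ H, ∀ x i, IsState (reuploadState (n := fun _ => n)
        (fun j => pmMap (W j)) (fun j => E j x) ρ₀ i) := fun W hW x i =>
      isState_reuploadState hW.1 (fun j => (hE j).1 x) hρ i
    obtain ⟨G, hG, hGD, hGs⟩ := exists_event_margin_bound hL hN S H (fun W hW => hW.2)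
      (fun W => pmModel E ρ₀ W)
      (fun W _ y => by
        simp only [pmModel, measure_eq_re]
        exact Complex.measurable_re.comp
          (measurable_reuploadState (n := fun _ => n) (fun j => pmMap (W j)) hE ρ₀ _ y y))
      (fun W hW x y y' => (hst W hW x _).measure_sub_le_one y y')
      (fun W => betaPM fun l => norm11 (W l)) one_pos
      (fun W _ => le_betaPM hL fun j => norm11_nonneg _)
      (fun W hW W' hW' τ hτ x y => by
        have hτ0 : 0 ≤ τ := (norm11_nonneg _).trans (hτ 0)
        have h := traceNorm_reuploadState_sub_le (n := fun _ => n) (r := fun _ => 1) hW.1 hW'.1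
          (fun j => (hE j).1 x) hρ (fun _ => one_pos) (c := fun j => norm11 (W j))
          (fun j => norm11_nonneg _) hτ0
          (fun j X hX => by
            rw [pmMap_eq, hX, zero_div, zero_smul, zero_add, div_one, one_mul]
            exact traceNorm_pmDeviation_le _ _)
          (fun j X => by
            rw [pmMap_eq, pmMap_eq, add_sub_add_left_eq_sub, ← pmDeviation_sub, div_one, one_mul]
            have := traceNorm_nonneg X
            exact (traceNorm_pmDeviation_le _ _).trans (by gcongr; exact hτ j))
        refine (measure_sub _ _ y ▸ abs_measure_le _ y).trans (h.trans_eq ?_)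
        simp [betaPM])
      (Fin.last L)
      (fun W hW x y y' => by
        have h := measure_sub_le_of_eq_add ((reuploadState_succ (n := fun _ => n)
          (fun j => pmMap (W j)) (fun j => E j x) ρ₀ (Fin.last L)).trans (pmMap_eq _ _)) y y'
        refine h.trans ?_
        have h1 := ((hE (Fin.last L)).1 x).isState_map (hst W hW x (Fin.last L).castSucc)
        have h2 := norm11_nonneg (W (Fin.last L))
        rw [mul_one]
        gcongr
        exact (traceNorm_pmDeviation_le _ _).trans
          (mul_le_of_le_one_right h2 h1.traceNorm_le_one))
      D hγ hδ hδ1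
    refine ⟨G, hG, hGD, fun s hs W hW hWS => (hGs s hs W ⟨hW, hWS⟩).trans ?_⟩
    gcongr
    exact sqrt_le_complexity hN _ hδ _ _ _
  · intro X _ L N n hn hL hN E hE ρ₀ hρ S D _ γ δ hγ hδ hδ1
    obtain ⟨L, rfl⟩ := Nat.exists_eq_add_of_le' hL
    have : Nonempty (Fin (n (Fin.last (L + 1)))) := ⟨⟨0, hn⟩⟩
    let H : Set (∀ j : Fin (L + 1), Matrix (PauliIdx (n j.succ)) (PauliIdx (n j.castSucc)) ℝ) :=
      {W | (∀ j, IsChannel (ptmMap (W j))) ∧ ∀ j, SupportedOn (W j) (S j)}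
    have hst : ∀ W ∈ H, ∀ x i, IsState (reuploadState (n := n)
        (fun j => ptmMap (W j)) (fun j => E j x) ρ₀ i) := fun W hW x i =>
      isState_reuploadState hW.1 (fun j => (hE j).1 x) hρ i
    obtain ⟨G, hG, hGD, hGs⟩ := exists_event_margin_bound hL hN S H (fun W hW => hW.2)
      (fun W => ptmModel n E ρ₀ W)
      (fun W _ y => by
        simp only [ptmModel, measure_eq_re]
        exact Complex.measurable_re.comp
          (measurable_reuploadState (fun j => ptmMap (W j)) hE ρ₀ _ y y))
      (fun W hW x y y' => (hst W hW x _).measure_sub_le_one y y')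
      (fun W => betaPTM n fun l => norm11 (W l))
      -- This is both the last summand of `betaPTM` and the expansion factor of the last layer per
      -- unit of `norm11`, so it serves in the lower bound on `β` and in the bound on margins.
      (κ := √((2 : ℝ) ^ n (Fin.last (L + 1))) / √((2 : ℝ) ^ n (Fin.last L).castSucc))
      (by positivity)
      (fun W _ => le_betaPTM fun j => norm11_nonneg _)
      (fun W hW W' hW' τ hτ x y => by
        have hτ0 : 0 ≤ τ := (norm11_nonneg _).trans (hτ 0)
        -- With this choice of `r` the dimension ratios telescope to the prefactors in `betaPTM`.
        have h := traceNorm_reuploadState_sub_le (n := n) (r := fun i => √((2 : ℝ) ^ n i))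
          hW.1 hW'.1 (fun j => (hE j).1 x) hρ (fun _ => by positivity)
          (c := fun j => norm11 (W j)) (fun j => norm11_nonneg _) hτ0
          (fun j X hX => by
            rw [ptmMap_eq, hX, zero_div, zero_smul, zero_add]
            exact traceNorm_ptmDeviation_le _ _)
          (fun j X => by
            rw [ptmMap_eq, ptmMap_eq, add_sub_add_left_eq_sub, ← ptmDeviation_sub]
            have := traceNorm_nonneg X
            exact (traceNorm_ptmDeviation_le _ _).trans (by gcongr; exact hτ j))
        exact (measure_sub _ _ y ▸ abs_measure_le _ y).trans h)
      (Fin.last L)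
      (fun W hW x y y' => by
        have h := measure_sub_le_of_eq_add ((reuploadState_succ (n := n)
          (fun j => ptmMap (W j)) (fun j => E j x) ρ₀ (Fin.last L)).trans (ptmMap_eq _ _)) y y'
        refine h.trans ?_
        have h1 := ((hE (Fin.last L)).1 x).isState_map (hst W hW x (Fin.last L).castSucc)
        have h2 := norm11_nonneg (W (Fin.last L))
        rw [mul_assoc]
        gcongr
        refine (traceNorm_ptmDeviation_le _ _).trans ?_
        exact mul_le_mul_of_nonneg_left (mul_le_of_le_one_right h2 h1.traceNorm_le_one)
          (by positivity))
      D hγ hδ hδ1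
    refine ⟨G, hG, hGD, fun s hs W hW hWS C _ => (hGs s hs W ⟨hW, hWS⟩).trans ?_⟩
    gcongr
    exact sqrt_le_complexity hN _ hδ _ _ _
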